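/- Let $\Omega=\mathbb R^2/\mathbb Z^2$ be the periodic unit square, let $\dot H^1(\Omega)$ be the space of mean-zero functions in $H^1(\Omega)$, and let $(-\Delta)^{1/2}$ be the Fourier multiplier with symbol $2\pi|{\bf k}|$, ${\bf k}\in\mathbb Z^2$. For mean-zero $\theta\in L^2(\Omega)$ let $\psi$ be the mean-zero solution of $(-\Delta)^{1/2}\psi=\theta$ and put ${\bf v}=\nabla^\perp\psi=(-\partial_2\psi,\partial_1\psi)$. For $\alpha>0$ and $\theta_0\in\dot H^1(\Omega)$, a regularized solution $\theta^\alpha$ with data $\theta_0$ is a function $\theta^\alpha\in C^1(\mathbb R,\dot H^1(\Omega))$ with $\theta^\alpha(0)=\theta_0$ and $$\partial_t(1-\alpha^2\Delta)\theta^\alpha+\operatorname{div}({\bf v}^\alpha\theta^\alpha)=0\quad\text{in the dual of }\dot H^1(\Omega)\text{ for every }t,$$ where ${\bf v}^\alpha(t)$ is the velocity of $\theta^\alpha(t)$. A function $\theta\in L^2(\Omega\times(-T,T))$ is a weak solution of the SQG equation with data $\theta_0$ if for almost every $t$ the function $\theta(\cdot,t)$ has mean zero, and, with ${\bf v}(\cdot,t)$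 the velocity of $\theta(\cdot,t)$, it satisfies for all real $\varphi\in C_c^\infty(\Omega\times(-T,T))$ $$\int_{-T}^{T}\!\int_\Omega \theta\,(\partial_t\varphi+{\bf v}\cdot\nabla\varphi)\,d{\bf x}\,dt=0,\qquad \int_{0}^{T}\!\int_\Omega \theta\,(\partial_t\varphi+{\bf v}\cdot\nabla\varphi)\,d{\bf x}\,dt=-\int_\Omega\theta_0\,\varphi(\cdot,0)\,d{\bf x}.$$ Theorem. Let $T>0$ and $\theta_0\in\dot H^1(\Omega)$. Every regularized solution $\theta^\alpha$, $0<\alpha\le1$, with data $\theta_0$ defines an element of $L^2(\Omega\times(-T,T))$, and the set of all these elements is relatively weakly compact in $L^2(\Omega\times(-T,T))$: its closure in the weak topology is weakly compact, and each sequence in the set has a subsequence that converges weakly in $L^2(\Omega\times(-T,T))$. Moreover, if $\alpha_n>0$, $\alpha_n\to0$, and regularized solutions $\theta^{\alpha_n}$ with data $\theta_0$ converge weakly in $L^2(\Omega\times(-T,T))$ to $\bar\theta\in L^2(\Omega\times(-T,T))$, then $\bar\theta$ is a weak solution of the SQG equation with data $\theta_0$. -/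

import Mathlib

open MeasureTheory Set Filter Topology
open scoped ContDiff ENNReal

noncomputable section

namespace SQG

/-! ### The periodic square and Fourier coefficients -/

/-- The periodic unit square `Ω = ℝ² / ℤ²`. -/
abbrev Torus : Type := UnitAddTorus (Fin 2)

/-- Lebesgue measure on the periodic unit square, of total mass one. It is written as the product of
the normalised Haar measures of the two circles, the measure for which `UnitAddTorus.mFourierCoeff`
is defined. -/
abbrev torusMeasure : Measure Torus :=
  Measure.pi (fun _ : Fin 2 => (AddCircle.haarAddCircle : Measure UnitAddCircle))

/-- The real Hilbert space `L²(Ω)`. -/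
abbrev L2 : Type := Lp ℝ 2 torusMeasure

/-- The Fourier coefficient `f̂(k) = ∫_Ω f(x) exp(-2πi k·x) dx` of a real function. -/
def fourierC (f : Torus → ℝ) (k : Fin 2 → ℤ) : ℂ :=
  UnitAddTorus.mFourierCoeff (fun x => (f x : ℂ)) k

/-- `g` is the (weak) partial derivative `∂_i f`: `ĝ(k) = 2πi k_i f̂(k)` for all `k`. -/
def IsPartial (i : Fin 2) (f g : Torus → ℝ) : Prop :=
  ∀ k : Fin 2 → ℤ, fourierC g k = 2 * Real.pi * Complex.I * (k i : ℂ) * fourierC f k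

/-- `ψ` is the stream function of `θ`: `(-Δ)^{1/2} ψ = θ` and `∫_Ω ψ = 0`. The symbol of
`(-Δ)^{1/2}` at the wave vector `2πk` is `2π|k|`. -/
def IsStreamFunction (θ ψ : Torus → ℝ) : Prop :=
  (∀ k : Fin 2 → ℤ,
    ((2 * Real.pi * Real.sqrt ((k 0 : ℝ) ^ 2 + (k 1 : ℝ) ^ 2) : ℝ) : ℂ) * fourierC ψ k
      = fourierC θ k) ∧
  ∫ x, ψ x ∂torusMeasure = 0

/-- `v = ∇^⊥ ψ = (-∂₂ψ, ∂₁ψ)`. -/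
def IsPerpGrad (ψ : Torus → ℝ) (v : Fin 2 → Torus → ℝ) : Prop :=
  IsPartial 1 ψ (fun x => - v 0 x) ∧ IsPartial 0 ψ (v 1)

lemma integrable_coe (f : L2) (k : Fin 2 → ℤ) :
    Integrable (fun x => UnitAddTorus.mFourier (-k) x • ((f x : ℝ) : ℂ)) torusMeasure := by
  have hf : Integrable (fun x => ((f x : ℝ) : ℂ)) torusMeasure :=
    ((Lp.memLp f).integrable (by norm_num)).ofReal
  refine hf.bdd_smul (φ := fun x => UnitAddTorus.mFourier (-k) x) 1
    (ContinuousMap.continuous _).aestronglyMeasurable ?_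
  refine Eventually.of_forall fun x => ?_
  exact ((UnitAddTorus.mFourier (-k)).norm_coe_le_norm x).trans
    (UnitAddTorus.mFourier_norm (n := -k)).le

lemma fourierC_add (f g : L2) (k : Fin 2 → ℤ) :
    fourierC (f + g : L2) k = fourierC f k + fourierC g k := by
  have h : fourierC (f + g : L2) k = ∫ x, (UnitAddTorus.mFourier (-k) x • ((f x : ℝ) : ℂ)
      + UnitAddTorus.mFourier (-k) x • ((g x : ℝ) : ℂ)) ∂torusMeasure := by
    refine integral_congr_ae ?_
    filter_upwards [Lp.coeFn_add f g] with x hx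
    rw [hx]
    simp [mul_add]
  rw [h, integral_add (integrable_coe f k) (integrable_coe g k)]
  rfl

lemma fourierC_smul (c : ℝ) (f : L2) (k : Fin 2 → ℤ) :
    fourierC (c • f : L2) k = c * fourierC f k := by
  have h : fourierC (c • f : L2) k
      = ∫ x, (c : ℂ) * (UnitAddTorus.mFourier (-k) x • ((f x : ℝ) : ℂ)) ∂torusMeasure := by
    refine integral_congr_ae ?_
    filter_upwards [Lp.coeFn_smul c f] with x hx
    rw [hx]
    simp
    ring
  rw [h, integral_const_mul]
  rfl

/-! ### The Sobolev space of mean-zero `H¹` functions -/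

/-- `Ḣ¹(Ω)`: the mean-zero `u ∈ L²(Ω)` with (weak) gradient in `L²(Ω)²`. An element is stored as the
pair `(u, ∇u)`, so that the inherited norm is `‖u‖² + ‖∂₁u‖² + ‖∂₂u‖²` under a square root. -/
def H1dot : Submodule ℝ (WithLp 2 (L2 × PiLp 2 (fun _ : Fin 2 => L2))) where
  carrier := {u | (∫ x, u.fst x ∂torusMeasure = 0) ∧ ∀ i, IsPartial i u.fst (u.snd i)}
  zero_mem' := by
    have h0 : ∀ k, fourierC (0 : L2) k = 0 := fun k => by
      have h := fourierC_smul 0 (0 : L2) k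
      rw [zero_smul] at h
      rw [h]
      simp
    refine ⟨?_, fun i k => ?_⟩
    · change ∫ x, (0 : L2) x ∂torusMeasure = 0
      rw [integral_congr_ae (Lp.coeFn_zero ℝ 2 torusMeasure)]
      simp
    · change fourierC (0 : L2) k = _ * fourierC (0 : L2) k
      rw [h0, mul_zero]
  add_mem' := by
    rintro a b ⟨ha, ha'⟩ ⟨hb, hb'⟩
    refine ⟨?_, fun i k => ?_⟩
    · change ∫ x, (a.fst + b.fst : L2) x ∂torusMeasure = 0
      rw [integral_congr_ae (Lp.coeFn_add a.fst b.fst)]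
      simp only [Pi.add_apply]
      rw [integral_add ((Lp.memLp a.fst).integrable (by norm_num))
        ((Lp.memLp b.fst).integrable (by norm_num)), ha, hb, add_zero]
    · change fourierC (a.snd i + b.snd i : L2) k = _ * fourierC (a.fst + b.fst : L2) k
      rw [fourierC_add, fourierC_add, ha' i k, hb' i k]
      ring
  smul_mem' := by
    rintro c a ⟨ha, ha'⟩
    refine ⟨?_, fun i k => ?_⟩
    · change ∫ x, (c • a.fst : L2) x ∂torusMeasure = 0
      rw [integral_congr_ae (Lp.coeFn_smul c a.fst)]
      simp only [Pi.smul_apply, smul_eq_mul]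
      rw [integral_const_mul, ha, mul_zero]
    · change fourierC (c • a.snd i : L2) k = _ * fourierC (c • a.fst : L2) k
      rw [fourierC_smul, fourierC_smul, ha' i k]
      ring

/-- The underlying `L²` function of an element of `Ḣ¹(Ω)`. -/
def h1Val (u : H1dot) : L2 := (u : WithLp 2 (L2 × PiLp 2 (fun _ : Fin 2 => L2))).fst

/-- The partial derivative `∂_i u ∈ L²(Ω)` of an element of `Ḣ¹(Ω)`. -/
def h1Grad (u : H1dot) (i : Fin 2) : L2 :=
  (u : WithLp 2 (L2 × PiLp 2 (fun _ : Fin 2 => L2))).snd i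

/-! ### The regularized problem -/

/-- `θ` is the global solution of the regularized problem
`∂_t (1 - α²Δ)θ + div(vθ) = 0`, `(-Δ)^{1/2}ψ = θ`, `v = ∇^⊥ψ`, `∫θ = ∫ψ = 0`, `θ(0) = θ₀`,
in the class `C¹(ℝ, Ḣ¹)`; the evolution equation holds at every time in the dual of `Ḣ¹`, i.e.
`⟨(1 - α²Δ)∂_tθ, φ⟩ = ∫ ∂_tθ φ + α² ∫ ∇∂_tθ·∇φ` equals `-⟨div(vθ), φ⟩ = ∫ θ v·∇φ`
for every `φ ∈ Ḣ¹`. -/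
structure IsRegularizedSolution (α : ℝ) (θ₀ : H1dot) (θ : ℝ → H1dot) : Prop where
  contDiff : ContDiff ℝ 1 θ
  initial : θ 0 = θ₀
  evolution : ∀ t : ℝ, ∃ (ψ : L2) (v : Fin 2 → L2),
    IsStreamFunction (h1Val (θ t)) ψ ∧ IsPerpGrad ψ (fun i => v i) ∧
    ∀ φ : H1dot,
      (∫ x, h1Val (deriv θ t) x * h1Val φ x ∂torusMeasure)
        + α ^ 2 * ∑ i, ∫ x, h1Grad (deriv θ t) i x * h1Grad φ i x ∂torusMeasure
      = ∫ x, h1Val (θ t) x * ∑ i, v i x * h1Grad φ i x ∂torusMeasure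

/-! ### Space-time functions -/

/-- Lebesgue measure on `Ω × (-T, T)`. -/
abbrev spaceTimeMeasure (T : ℝ) : Measure (Torus × ℝ) :=
  torusMeasure.prod ((volume : Measure ℝ).restrict (Ioo (-T) T))

/-- The real Hilbert space `L²(Ω × (-T, T))`. -/
abbrev L2ST (T : ℝ) : Type := Lp ℝ 2 (spaceTimeMeasure T)

/-- `u ∈ L²(Ω × (-T, T))` is the space-time function `(x, t) ↦ θ(t)(x)` of the curve `θ` in
`Ḣ¹(Ω)`. -/
def Represents {T : ℝ} (u : L2ST T) (θ : ℝ → H1dot) : Prop :=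
  ∀ᵐ t ∂((volume : Measure ℝ).restrict (Ioo (-T) T)),
    ∀ᵐ x ∂torusMeasure, u (x, t) = h1Val (θ t) x

/-- The set of the regularized solutions `θ^α`, `0 < α ≤ 1`, with initial value `θ₀`, as a subset of
`L²(Ω × (-T, T))`. -/
def regularizedSet (T : ℝ) (θ₀ : H1dot) : Set (L2ST T) :=
  {u | ∃ α ∈ Ioc (0 : ℝ) 1, ∃ θ : ℝ → H1dot, IsRegularizedSolution α θ₀ θ ∧ Represents u θ}

/-- Test functions: smooth on `Ω × ℝ` (i.e. smooth and periodic when pulled back to `ℝ² × ℝ`), with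
compact support in `Ω × (-T, T)`. -/
structure IsTestFunction (T : ℝ) (φ : Torus × ℝ → ℝ) : Prop where
  smooth : ContDiff ℝ ∞
    (fun p : (Fin 2 → ℝ) × ℝ => φ ((fun i => (p.1 i : UnitAddCircle)), p.2))
  hasCompactSupport : HasCompactSupport φ
  support_subset : tsupport φ ⊆ univ ×ˢ Ioo (-T) T

/-- The time derivative `∂_t φ`. -/
def dt (φ : Torus × ℝ → ℝ) (p : Torus × ℝ) : ℝ := deriv (fun s => φ (p.1, s)) p.2

/-- The spatial derivative `∂_i φ`, along the translations of the torus. -/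
def dx (i : Fin 2) (φ : Torus × ℝ → ℝ) (p : Torus × ℝ) : ℝ :=
  deriv (fun s : ℝ => φ (p.1 + Pi.single i (s : UnitAddCircle), p.2)) 0

/-- `θ ∈ L²(Ω × (-T, T))` is a weak solution of the surface quasi-geostrophic equations
`∂_tθ + div(vθ) = 0`, `(-Δ)^{1/2}ψ = θ`, `v = ∇^⊥ψ`, `∫θ = ∫ψ = ∫v = 0`, `θ(·,0) = θ₀`.
The first clause (for almost every `t`) determines `ψ` and `v` from `θ`, the second is the equation
in the sense of distributions on `Ω × (-T, T)`, and the third is the equation on `0 < t < T`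
including the initial value (subtracted from the second it gives the equation on `-T < t < 0` with
the same value at `t = 0`). -/
def IsWeakSolution (T : ℝ) (θ₀ : L2) (θ : L2ST T) : Prop :=
  ∃ (ψ : L2ST T) (v : Fin 2 → L2ST T),
    (∀ᵐ t ∂((volume : Measure ℝ).restrict (Ioo (-T) T)),
      IsStreamFunction (fun x => θ (x, t)) (fun x => ψ (x, t)) ∧
      IsPerpGrad (fun x => ψ (x, t)) (fun i x => v i (x, t)) ∧
      (∫ x, θ (x, t) ∂torusMeasure = 0) ∧ ∀ i, ∫ x, v i (x, t) ∂torusMeasure = 0) ∧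
    (∀ φ : Torus × ℝ → ℝ, IsTestFunction T φ →
      ∫ p in univ ×ˢ Ioo (-T) T, θ p * (dt φ p + ∑ i, v i p * dx i φ p)
        ∂(torusMeasure.prod volume) = 0) ∧
    (∀ φ : Torus × ℝ → ℝ, IsTestFunction T φ →
      ∫ p in univ ×ˢ Ioo 0 T, θ p * (dt φ p + ∑ i, v i p * dx i φ p)
        ∂(torusMeasure.prod volume) = - ∫ x, θ₀ x * φ (x, 0) ∂torusMeasure)

end SQG

end

noncomputable section

namespace SQG

open UnitAddTorus ComplexConjugate

/-! ### Weak compactness and weak convergence in a Hilbert space. -/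

section WeakTopology

variable {H : Type*} [NormedAddCommGroup H] [InnerProductSpace ℝ H] [CompleteSpace H]

/-! Everything is done on Fourier coefficients in space. Tested against trigonometric polynomials,
the regularized problem becomes the family of scalar equations (1 + α²(2π|l|)²) ∂ₜθ̂(l) = N(θ̂)(l),
where N(a)(l) = 2π Σⱼ (l×j)/|j| a(l−j) a(j) (`IsRegularizedSolution.mode_eq`).

Bounds. The involution (l, j) ↦ (j−l, j) reverses the sign of the trilinear form Σ N(a)(l) conj a(l)
for real data, so this form vanishes (`hasSum_nonlin_mul_conj`); the H¹ regularity supplies the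
absolute convergence. Hence ‖θ‖² + α²‖∇θ‖² is conserved (`IsRegularizedSolution.energy_eq`), and for
α ≤ 1 the solutions stay in a fixed ball of L². Weak compactness follows from Banach–Alaoglu and
Riesz.

Limit. No strong compactness is available, but the nonlinearity is weakly continuous. Averaging the
series over j ↔ l−j replaces its symbol by ½ (l×j)(1/|j| − 1/|l−j|), which is at most |l|²/|j| and
so tends to zero at infinity (`abs_symSymbol_le`). On bounded subsets of ℓ², coefficientwise
convergence is therefore enough to pass to the limit in N (`tendsto_nonlin`).

Weak convergence in space-time controls only time integrals of the coefficients. The mode equation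
makes each coefficient Lipschitz in time uniformly in α, which turns this into convergence at almost
every time (`ae_tendsto_fourierC`). Dominated convergence then gives the integrated mode equations
for the limit. The decay of the coefficients of the test function allows them to be summed, and
Parseval on time slices turns the sum into the weak formulation (`weak_form_limit`). Stream function
and velocity of the limit are built by bounded Fourier multipliers (`exists_stream_velocity`). -/

lemma isCompact_closure_toWeakSpace_image {S : Set H} (hS : Bornology.IsBounded S) :
    IsCompact (closure (toWeakSpace ℝ H '' S)) := by
  refine NormedSpace.isCompact_closure_of_isBounded ℝ H _ ?_ ?_
  · rwa [Set.preimage_image_eq _ (toWeakSpace ℝ H).injective]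
  -- Reflexivity: a functional on the dual, read through the Riesz map, is an element of the dual
  -- and hence represented by a vector of `H`.
  · intro Φ _
    let y : StrongDual ℝ H := (WeakDual.toStrongDual Φ).comp (innerSL ℝ)
    refine ⟨toWeakSpace ℝ H ((InnerProductSpace.toDual ℝ H).symm y), ?_⟩
    refine DFunLike.ext _ _ fun l => ?_
    change l ((InnerProductSpace.toDual ℝ H).symm y) = Φ l
    have h1 : l ((InnerProductSpace.toDual ℝ H).symm y)
        = inner ℝ ((InnerProductSpace.toDual ℝ H).symm l)
            ((InnerProductSpace.toDual ℝ H).symm y) := by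
      rw [InnerProductSpace.toDual_symm_apply]
    rw [h1, real_inner_comm, InnerProductSpace.toDual_symm_apply]
    change Φ (InnerProductSpace.toDual ℝ H ((InnerProductSpace.toDual ℝ H).symm l)) = Φ l
    rw [LinearIsometryEquiv.apply_symm_apply]

lemma tendsto_toWeakSpace_iff {ι : Type*} {F : Filter ι} {u : ι → H} {w : H} :
    Tendsto (fun n => toWeakSpace ℝ H (u n)) F (𝓝 (toWeakSpace ℝ H w)) ↔
      ∀ h : H, Tendsto (fun n => inner ℝ h (u n)) F (𝓝 (inner ℝ h w)) := by
  rw [(NormedSpace.isEmbedding_inclusionInDoubleDualWeak ℝ H).tendsto_nhds_iff,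
    tendsto_iff_forall_eval_tendsto_topDualPairing]
  constructor
  · intro h x
    exact h (InnerProductSpace.toDual ℝ H x)
  · intro h l
    have := h ((InnerProductSpace.toDual ℝ H).symm l)
    simp only [InnerProductSpace.toDual_symm_apply] at this
    exact this

lemma exists_subseq_tendsto_toWeakSpace [TopologicalSpace.SeparableSpace H] {u : ℕ → H} {R : ℝ}
    (hu : ∀ n, ‖u n‖ ≤ R) : ∃ (w : H) (σ : ℕ → ℕ), StrictMono σ ∧
      Tendsto (fun n => toWeakSpace ℝ H (u (σ n))) atTop (𝓝 (toWeakSpace ℝ H w)) := by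
  -- Separability gives the sequential form of Banach–Alaoglu in the dual; Riesz carries it back to
  -- `H`.
  obtain ⟨a, -, σ, hσ, ha⟩ := WeakDual.isSeqCompact_closedBall ℝ H 0 R
    (x := fun n => StrongDual.toWeakDual (InnerProductSpace.toDual ℝ H (u n))) (fun n => by
      change InnerProductSpace.toDual ℝ H (u n) ∈ Metric.closedBall 0 R
      rw [mem_closedBall_zero_iff, LinearIsometryEquiv.norm_map]
      exact hu n)
  refine ⟨(InnerProductSpace.toDual ℝ H).symm (WeakDual.toStrongDual a), σ, hσ, ?_⟩
  rw [tendsto_toWeakSpace_iff]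
  intro h
  rw [tendsto_iff_forall_eval_tendsto_topDualPairing] at ha
  have := ha h
  rw [real_inner_comm, InnerProductSpace.toDual_symm_apply]
  simp only [real_inner_comm _ h]
  exact this

end WeakTopology

/-! ### Parseval identities and Fourier coefficients of real functions. -/

section Parseval

lemma memLp_ofReal {X : Type*} [MeasurableSpace X] {μ : Measure X} {p : ℝ≥0∞} {f : X → ℝ}
    (hf : MemLp f p μ) : MemLp (fun x => (f x : ℂ)) p μ := hf.ofReal

lemma hasSum_mFourierCoeff_mul {F G : Torus → ℂ} (hF : MemLp F 2 torusMeasure)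
    (hG : MemLp G 2 torusMeasure) :
    HasSum (fun k => conj (mFourierCoeff F k) * mFourierCoeff G k)
      (∫ x, conj (F x) * G x ∂torusMeasure) := by
  have h := hasSum_prod_mFourierCoeff (d := Fin 2) (hF.toLp F) (hG.toLp G)
  have hc : ∀ {F : Torus → ℂ} (hF : MemLp F 2 torusMeasure) (k : Fin 2 → ℤ),
      mFourierCoeff (hF.toLp F) k = mFourierCoeff F k := fun hF k => by
    refine integral_congr_ae (μ := torusMeasure) ?_
    filter_upwards [hF.coeFn_toLp] with x hx
    rw [hx]
  simp only [hc] at h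
  convert h using 1
  refine integral_congr_ae ?_
  filter_upwards [hF.coeFn_toLp, hG.coeFn_toLp] with x hx hy
  rw [hx, hy]

lemma hasSum_fourierC_mul {f g : Torus → ℝ} (hf : MemLp f 2 torusMeasure)
    (hg : MemLp g 2 torusMeasure) :
    HasSum (fun k => conj (fourierC f k) * fourierC g k)
      ((∫ x, f x * g x ∂torusMeasure : ℝ) : ℂ) := by
  convert hasSum_mFourierCoeff_mul (memLp_ofReal hf) (memLp_ofReal hg) using 1
  · rfl
  rw [← integral_complex_ofReal]
  refine integral_congr_ae (Eventually.of_forall fun x => ?_)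
  simp

lemma hasSum_fourierC_sq {f : Torus → ℝ} (hf : MemLp f 2 torusMeasure) :
    HasSum (fun k => ‖fourierC f k‖ ^ 2) (∫ x, f x ^ 2 ∂torusMeasure) := by
  have h := Complex.hasSum_re (hasSum_fourierC_mul hf hf)
  convert h using 1
  · ext k
    rw [Complex.conj_mul', ← Complex.ofReal_pow, Complex.ofReal_re]
  · rw [Complex.ofReal_re]
    simp only [sq]

lemma integral_L2_sq (f : L2) : ∫ x, f x ^ 2 ∂torusMeasure = ‖f‖ ^ 2 := by
  rw [← real_inner_self_eq_norm_sq, L2.inner_def]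
  simp [sq]

lemma hasSum_fourierC_L2_sq (f : L2) : HasSum (fun k => ‖fourierC f k‖ ^ 2) (‖f‖ ^ 2) := by
  rw [← integral_L2_sq]
  exact hasSum_fourierC_sq (Lp.memLp f)

lemma hasSum_fourierC_inner (f g : L2) :
    HasSum (fun k => conj (fourierC f k) * fourierC g k) ((inner ℝ f g : ℝ) : ℂ) := by
  convert hasSum_fourierC_mul (Lp.memLp f) (Lp.memLp g) using 2
  rw [L2.inner_def]
  simp [mul_comm]

lemma fourierC_congr {f g : Torus → ℝ} (h : f =ᵐ[torusMeasure] g) (k : Fin 2 → ℤ) :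
    fourierC f k = fourierC g k := by
  refine integral_congr_ae (μ := torusMeasure) ?_
  filter_upwards [h] with x hx
  rw [hx]

lemma fourierC_eq (f : Torus → ℝ) (k : Fin 2 → ℤ) :
    fourierC f k = ∫ x, mFourier (-k) x * (f x : ℂ) ∂torusMeasure := rfl

lemma fourierC_neg_index (f : Torus → ℝ) (k : Fin 2 → ℤ) :
    fourierC f (-k) = conj (fourierC f k) := by
  rw [fourierC_eq, fourierC_eq, ← integral_conj]
  refine integral_congr_ae (Eventually.of_forall fun x => ?_)
  simp [mFourier_neg]

lemma fourierC_neg (f : Torus → ℝ) (k : Fin 2 → ℤ) :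
    fourierC (fun x => - f x) k = - fourierC f k := by
  rw [fourierC_eq, fourierC_eq, ← integral_neg]
  refine integral_congr_ae (Eventually.of_forall fun x => ?_)
  simp

lemma fourierC_zero_index (f : Torus → ℝ) :
    fourierC f 0 = ((∫ x, f x ∂torusMeasure : ℝ) : ℂ) := by
  rw [fourierC_eq, ← integral_complex_ofReal]
  simp [mFourier_zero]

lemma fourierC_zero_index_eq_zero_iff (f : Torus → ℝ) :
    fourierC f 0 = 0 ↔ ∫ x, f x ∂torusMeasure = 0 := by
  rw [fourierC_zero_index, Complex.ofReal_eq_zero]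

lemma ae_eq_of_fourierC_eq {f g : Torus → ℝ} (hf : MemLp f 2 torusMeasure)
    (hg : MemLp g 2 torusMeasure) (h : ∀ k, fourierC f k = fourierC g k) :
    f =ᵐ[torusMeasure] g := by
  have hd := hasSum_fourierC_sq (hf.sub hg)
  have h0 : ∀ k, fourierC (f - g) k = 0 := fun k => by
    have hi : ∀ {f : Torus → ℝ}, MemLp f 2 torusMeasure →
        Integrable (fun x => mFourier (-k) x * (f x : ℂ)) torusMeasure := fun {f} hf =>
      (hf.integrable (by norm_num)).ofReal.bdd_mul (c := 1)
        (ContinuousMap.continuous _).aestronglyMeasurable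
        (Eventually.of_forall fun x => ((mFourier (-k)).norm_coe_le_norm x).trans
          (mFourier_norm (n := -k)).le)
    have := integral_sub (hi hf) (hi hg)
    rw [← fourierC_eq, ← fourierC_eq, h k, sub_self] at this
    rw [← this, fourierC_eq]
    simp [mul_sub]
  simp only [h0] at hd
  have h1 : ∫ x, (f - g) x ^ 2 ∂torusMeasure = 0 := by
    refine hd.unique ?_
    simp
  rw [integral_eq_zero_iff_of_nonneg (fun x => sq_nonneg _) (hf.sub hg).integrable_sq] at h1
  filter_upwards [h1] with x hx
  simpa [sub_eq_zero] using hx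

lemma norm_mFourier_apply (k : Fin 2 → ℤ) (x : Torus) : ‖mFourier k x‖ = 1 := by
  simp [mFourier, fourier_apply, Circle.norm_coe]

/-- The Fourier coefficients of a product are the convolution of the Fourier coefficients. -/
lemma hasSum_fourierC_conv {f g : Torus → ℝ} (hf : MemLp f 2 torusMeasure)
    (hg : MemLp g 2 torusMeasure) (l : Fin 2 → ℤ) :
    HasSum (fun j => fourierC f (l - j) * fourierC g j) (fourierC (fun x => f x * g x) l) := by
  have hF : MemLp (fun x => mFourier l x * (f x : ℂ)) 2 torusMeasure := by
    refine MemLp.of_le (memLp_ofReal hf)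
      ((ContinuousMap.continuous _).aestronglyMeasurable.mul (memLp_ofReal hf).1)
      (Eventually.of_forall fun x => ?_)
    rw [norm_mul, norm_mFourier_apply, one_mul]
  convert hasSum_mFourierCoeff_mul hF (memLp_ofReal hg) using 1
  · ext j
    congr 1
    rw [← neg_sub j l, fourierC_neg_index, fourierC_eq]
    congr 1
    refine integral_congr_ae (μ := torusMeasure) (Eventually.of_forall fun x => ?_)
    simp only [smul_eq_mul, ← mul_assoc, ← mFourier_add]
    congr 2
    abel_nf
  · rw [fourierC_eq]
    refine integral_congr_ae (Eventually.of_forall fun x => ?_)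
    simp [mFourier_neg, mul_assoc]

lemma norm_fourierC_le_integral (f : Torus → ℝ) (k : Fin 2 → ℤ) :
    ‖fourierC f k‖ ≤ ∫ x, ‖f x‖ ∂torusMeasure := by
  rw [fourierC_eq]
  refine (norm_integral_le_integral_norm _).trans (le_of_eq ?_)
  simp [norm_mFourier_apply]

lemma norm_fourierC_L2_le (f : L2) (k : Fin 2 → ℤ) : ‖fourierC f k‖ ≤ ‖f‖ := by
  have h := le_hasSum (hasSum_fourierC_L2_sq f) k fun _ _ => sq_nonneg _
  exact le_of_sq_le_sq h (norm_nonneg _)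

/-- The `k`-th Fourier coefficient as a continuous linear functional on `L²(Ω)`. -/
def fourierCLM (k : Fin 2 → ℤ) : L2 →L[ℝ] ℂ :=
  LinearMap.mkContinuous
    { toFun := fun f => fourierC f k
      map_add' := fun f g => fourierC_add f g k
      map_smul' := fun c f => by simpa using fourierC_smul c f k } 1
    (fun f => by simpa using norm_fourierC_L2_le f k)

end Parseval

/-! ### Lattice sums and the symbol of the nonlinearity. -/

section Symbols

/-- The Euclidean length of a wave vector. -/
def freqNorm (k : Fin 2 → ℤ) : ℝ := Real.sqrt ((k 0 : ℝ) ^ 2 + (k 1 : ℝ) ^ 2)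

lemma freqNorm_nonneg (k : Fin 2 → ℤ) : 0 ≤ freqNorm k := Real.sqrt_nonneg _

lemma freqNorm_sq (k : Fin 2 → ℤ) : freqNorm k ^ 2 = (k 0 : ℝ) ^ 2 + (k 1 : ℝ) ^ 2 :=
  Real.sq_sqrt (by positivity)

lemma freqNorm_zero : freqNorm 0 = 0 := by simp [freqNorm]

lemma freqNorm_neg (k : Fin 2 → ℤ) : freqNorm (-k) = freqNorm k := by simp [freqNorm]

lemma freqNorm_eq_norm (k : Fin 2 → ℤ) :
    freqNorm k = ‖(((k 0 : ℝ) : ℂ) + ((k 1 : ℝ) : ℂ) * Complex.I)‖ := by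
  rw [Complex.norm_add_mul_I, freqNorm]

lemma abs_freqNorm_sub_le (j k : Fin 2 → ℤ) :
    |freqNorm j - freqNorm k| ≤ freqNorm (j - k) := by
  simp only [freqNorm_eq_norm]
  refine (abs_norm_sub_norm_le _ _).trans (le_of_eq ?_)
  congr 1
  simp
  ring

lemma abs_apply_le_freqNorm (k : Fin 2 → ℤ) (i : Fin 2) : |(k i : ℝ)| ≤ freqNorm k := by
  refine Real.abs_le_sqrt ?_
  fin_cases i
  · exact le_add_of_nonneg_right (sq_nonneg _)
  · exact le_add_of_nonneg_left (sq_nonneg _)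

lemma norm_le_freqNorm (k : Fin 2 → ℤ) : ‖k‖ ≤ freqNorm k :=
  (pi_norm_le_iff_of_nonneg (freqNorm_nonneg k)).2 fun i => by
    rw [Int.norm_eq_abs]
    exact abs_apply_le_freqNorm k i

lemma freqNorm_le_two_mul_norm (k : Fin 2 → ℤ) : freqNorm k ≤ 2 * ‖k‖ := by
  have h : ∀ i, |(k i : ℝ)| ≤ ‖k‖ := fun i => by
    rw [← Int.norm_eq_abs]
    exact norm_le_pi_norm k i
  refine Real.sqrt_le_iff.2 ⟨by positivity, ?_⟩
  have h0 := sq_le_sq' (abs_le.1 (h 0)).1 (abs_le.1 (h 0)).2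
  have h1 := sq_le_sq' (abs_le.1 (h 1)).1 (abs_le.1 (h 1)).2
  nlinarith [norm_nonneg k]

lemma one_le_norm {k : Fin 2 → ℤ} (hk : k ≠ 0) : 1 ≤ ‖k‖ := by
  obtain ⟨i, hi⟩ := Function.ne_iff.1 hk
  refine le_trans ?_ (norm_le_pi_norm k i)
  rw [Int.norm_eq_abs]
  exact_mod_cast Int.one_le_abs hi

lemma one_le_freqNorm {k : Fin 2 → ℤ} (hk : k ≠ 0) : 1 ≤ freqNorm k :=
  (one_le_norm hk).trans (norm_le_freqNorm k)

lemma freqNorm_pos {k : Fin 2 → ℤ} (hk : k ≠ 0) : 0 < freqNorm k :=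
  zero_lt_one.trans_le (one_le_freqNorm hk)

lemma summable_norm_inv_pow {n : ℕ} (hn : 3 ≤ n) :
    Summable fun k : Fin 2 → ℤ => (‖k‖ ^ n)⁻¹ := by
  have h := EisensteinSeries.summable_one_div_norm_rpow (k := n) (by exact_mod_cast hn)
  refine h.congr fun k => ?_
  rw [Real.rpow_neg (norm_nonneg _), Real.rpow_natCast]

lemma summable_freqNorm_inv_pow {n : ℕ} (hn : 3 ≤ n) :
    Summable fun k : Fin 2 → ℤ => (freqNorm k ^ n)⁻¹ := by
  refine (summable_norm_inv_pow hn).of_nonneg_of_le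
    (fun k => inv_nonneg.2 (pow_nonneg (freqNorm_nonneg k) _)) fun k => ?_
  rcases eq_or_ne k 0 with rfl | hk
  · simp [freqNorm_zero]
  · have := one_le_norm hk
    have := norm_le_freqNorm k
    gcongr

/-- The cross product of two wave vectors. -/
def cross (l j : Fin 2 → ℤ) : ℝ := (l 1 : ℝ) * j 0 - l 0 * j 1

lemma abs_cross_le (l j : Fin 2 → ℤ) : |cross l j| ≤ freqNorm l * freqNorm j := by
  refine abs_le_of_sq_le_sq ?_ (mul_nonneg (freqNorm_nonneg l) (freqNorm_nonneg j))
  rw [mul_pow, freqNorm_sq, freqNorm_sq, cross]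
  nlinarith [sq_nonneg ((l 0 : ℝ) * j 0 + l 1 * j 1)]

lemma cross_sub_right (l j : Fin 2 → ℤ) : cross l (l - j) = - cross l j := by
  simp only [cross, Pi.sub_apply, Int.cast_sub]
  ring

lemma cross_sub_left (l j : Fin 2 → ℤ) : cross (j - l) j = - cross l j := by
  simp only [cross, Pi.sub_apply, Int.cast_sub]
  ring

/-- The symbol of the nonlinearity: `-i l · v̂(j) = (crossSymbol l j) θ̂(j)`. -/
def crossSymbol (l j : Fin 2 → ℤ) : ℝ := cross l j / freqNorm j

lemma abs_crossSymbol_le (l j : Fin 2 → ℤ) : |crossSymbol l j| ≤ freqNorm l := by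
  rw [crossSymbol, abs_div, abs_of_nonneg (freqNorm_nonneg j)]
  exact div_le_of_le_mul₀ (freqNorm_nonneg j) (freqNorm_nonneg l) (abs_cross_le l j)

/-- The symmetrized symbol of the nonlinearity. -/
def symSymbol (l j : Fin 2 → ℤ) : ℝ := (crossSymbol l j + crossSymbol l (l - j)) / 2

/-- Because l×(l−j) = −l×j, the symmetrized symbol is ½ (l×j)(1/|j| − 1/|l−j|). The difference of
the lengths |j| and |l−j| is at most |l|, and |l×(l−j)| ≤ |l||l−j| cancels one factor of the
denominator. This gain of |j|⁻¹ is what makes the nonlinearity weakly continuous. -/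
lemma abs_symSymbol_le (l j : Fin 2 → ℤ) :
    |symSymbol l j| ≤ freqNorm l ^ 2 * (freqNorm j)⁻¹ := by
  have hnn : 0 ≤ freqNorm l ^ 2 * (freqNorm j)⁻¹ :=
    mul_nonneg (sq_nonneg _) (inv_nonneg.2 (freqNorm_nonneg j))
  have hll : cross l l = 0 := by rw [cross]; ring
  rcases eq_or_ne j 0 with rfl | hj
  · have : symSymbol l 0 = 0 := by simp [symSymbol, crossSymbol, hll, freqNorm_zero]
    rw [this, abs_zero]
    exact hnn
  rcases eq_or_ne (l - j) 0 with hlj | hlj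
  · have : symSymbol l j = 0 := by
      have : j = l := (sub_eq_zero.1 hlj).symm
      subst this
      simp [symSymbol, crossSymbol, hll, freqNorm_zero]
    rw [this, abs_zero]
    exact hnn
  have hj' := freqNorm_pos hj
  have hlj' := freqNorm_pos hlj
  have h1 : symSymbol l j
      = - cross l (l - j) * (freqNorm (l - j) - freqNorm j)
          / (2 * freqNorm j * freqNorm (l - j)) := by
    rw [symSymbol, crossSymbol, crossSymbol, cross_sub_right]
    field_simp
    ring
  have h2 : |freqNorm (l - j) - freqNorm j| ≤ freqNorm l := by
    rw [abs_sub_comm, ← freqNorm_neg j]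
    have := abs_freqNorm_sub_le (l - j) (-j)
    rwa [sub_neg_eq_add, sub_add_cancel, abs_sub_comm] at this
  rw [h1, abs_div, abs_mul, abs_neg, abs_of_pos (by positivity : 0 < 2 * freqNorm j * freqNorm (l - j)),
    div_le_iff₀ (by positivity)]
  calc |cross l (l - j)| * |freqNorm (l - j) - freqNorm j|
      ≤ (freqNorm l * freqNorm (l - j)) * freqNorm l :=
        mul_le_mul (abs_cross_le _ _) h2 (abs_nonneg _)
          (mul_nonneg (freqNorm_nonneg _) (freqNorm_nonneg _))
    _ = freqNorm l ^ 2 * freqNorm (l - j) := by ring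
    _ ≤ 2 * (freqNorm l ^ 2 * freqNorm (l - j)) := by
        linarith [mul_nonneg (sq_nonneg (freqNorm l)) hlj'.le]
    _ = freqNorm l ^ 2 * (freqNorm j)⁻¹ * (2 * freqNorm j * freqNorm (l - j)) := by
        field_simp

lemma tendsto_symSymbol (l : Fin 2 → ℤ) :
    Tendsto (fun j => (symSymbol l j : ℂ)) cofinite (𝓝 0) := by
  -- The decay of |j|⁻¹ is the cube root of the decay of the terms of a convergent series.
  have h := (summable_freqNorm_inv_pow (le_refl 3)).tendsto_cofinite_zero
  have h3 : Tendsto (fun j : Fin 2 → ℤ => freqNorm l ^ 2 * (freqNorm j)⁻¹) cofinite (𝓝 0) := by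
    have h4 : Tendsto (fun j : Fin 2 → ℤ => (freqNorm j)⁻¹) cofinite (𝓝 0) := by
      have h5 := h.rpow_const (p := 1 / 3) (Or.inr (by norm_num))
      rw [Real.zero_rpow (by norm_num)] at h5
      refine h5.congr fun j => ?_
      rw [← inv_pow, ← Real.rpow_natCast, ← Real.rpow_mul (inv_nonneg.2 (freqNorm_nonneg j))]
      norm_num
    simpa using h4.const_mul (freqNorm l ^ 2)
  refine squeeze_zero_norm (fun j => ?_) h3
  rw [Complex.norm_real]
  exact abs_symSymbol_le l j

end Symbols

/-! ### The quadratic nonlinearity: bounds, weak continuity, vanishing energy flux. -/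

section Nonlinearity

variable {a : (Fin 2 → ℤ) → ℂ}

lemma summable_norm_mul_sub (ha : Summable fun k => ‖a k‖ ^ 2) (l : Fin 2 → ℤ) :
    Summable (fun j => ‖a (l - j) * a j‖) ∧ ∑' j, ‖a (l - j) * a j‖ ≤ ∑' k, ‖a k‖ ^ 2 := by
  have h1 : Summable fun j => ‖a (l - j)‖ ^ 2 := by
    have := ((Equiv.subLeft l).summable_iff (f := fun k => ‖a k‖ ^ 2)).2 ha
    exact this
  have h2 : Summable fun j => (‖a (l - j)‖ ^ 2 + ‖a j‖ ^ 2) / 2 := (h1.add ha).div_const 2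
  have hle : ∀ j, ‖a (l - j) * a j‖ ≤ (‖a (l - j)‖ ^ 2 + ‖a j‖ ^ 2) / 2 := fun j => by
    rw [norm_mul]
    nlinarith [sq_nonneg (‖a (l - j)‖ - ‖a j‖)]
  have hs := h2.of_nonneg_of_le (fun _ => norm_nonneg _) hle
  refine ⟨hs, (hs.tsum_le_tsum hle h2).trans (le_of_eq ?_)⟩
  have he : ∑' j, ‖a (l - j)‖ ^ 2 = ∑' k, ‖a k‖ ^ 2 :=
    (Equiv.subLeft l).tsum_eq (fun k => ‖a k‖ ^ 2)
  rw [tsum_div_const, h1.tsum_add ha, he]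
  ring

/-- The Fourier coefficients of `-div(vθ)` in terms of those of `θ`. -/
def nonlin (a : (Fin 2 → ℤ) → ℂ) (l : Fin 2 → ℤ) : ℂ :=
  2 * Real.pi * ∑' j, (crossSymbol l j : ℂ) * (a (l - j) * a j)

lemma summable_crossSymbol_mul (ha : Summable fun k => ‖a k‖ ^ 2) (l : Fin 2 → ℤ) :
    Summable fun j => ‖(crossSymbol l j : ℂ) * (a (l - j) * a j)‖ := by
  refine ((summable_norm_mul_sub ha l).1.mul_left (freqNorm l)).of_nonneg_of_le
    (fun _ => norm_nonneg _) fun j => ?_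
  rw [norm_mul, Complex.norm_real]
  exact mul_le_mul_of_nonneg_right (abs_crossSymbol_le l j) (norm_nonneg _)

/-- Only the ℓ² norm of the coefficients enters, so the bound is uniform in α. It serves both as the
Lipschitz constant in time and as the dominating function in the limit. -/
lemma norm_nonlin_le (ha : Summable fun k => ‖a k‖ ^ 2) (l : Fin 2 → ℤ) :
    ‖nonlin a l‖ ≤ 2 * Real.pi * freqNorm l * ∑' k, ‖a k‖ ^ 2 := by
  have h1 : ‖∑' j, (crossSymbol l j : ℂ) * (a (l - j) * a j)‖
      ≤ freqNorm l * ∑' k, ‖a k‖ ^ 2 := by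
    refine (norm_tsum_le_tsum_norm (summable_crossSymbol_mul ha l)).trans ?_
    calc ∑' j, ‖(crossSymbol l j : ℂ) * (a (l - j) * a j)‖
        ≤ ∑' j, freqNorm l * ‖a (l - j) * a j‖ := by
          refine (summable_crossSymbol_mul ha l).tsum_le_tsum (fun j => ?_)
            ((summable_norm_mul_sub ha l).1.mul_left _)
          rw [norm_mul, Complex.norm_real]
          exact mul_le_mul_of_nonneg_right (abs_crossSymbol_le l j) (norm_nonneg _)
      _ = freqNorm l * ∑' j, ‖a (l - j) * a j‖ := tsum_mul_left
      _ ≤ _ := mul_le_mul_of_nonneg_left (summable_norm_mul_sub ha l).2 (freqNorm_nonneg l)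
  rw [nonlin, norm_mul, mul_assoc _ (freqNorm l)]
  refine mul_le_mul (le_of_eq ?_) h1 (norm_nonneg _) (by positivity)
  rw [norm_mul, Complex.norm_real, Real.norm_of_nonneg Real.pi_pos.le]
  simp

lemma nonlin_zero_index : nonlin a 0 = 0 := by
  simp [nonlin, crossSymbol, cross]

/-- The product a(l−j) a(j) is invariant under j ↦ l−j, so the absolutely convergent series may be
averaged with its image under this bijection. -/
lemma nonlin_eq_symSymbol (ha : Summable fun k => ‖a k‖ ^ 2) (l : Fin 2 → ℤ) :
    nonlin a l = 2 * Real.pi * ∑' j, (symSymbol l j : ℂ) * (a (l - j) * a j) := by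
  rw [nonlin]
  congr 1
  have h := (summable_crossSymbol_mul ha l).of_norm
  have h' := (Equiv.subLeft l).summable_iff.2 h
  have he := (Equiv.subLeft l).tsum_eq fun j => (crossSymbol l j : ℂ) * (a (l - j) * a j)
  have hsum := h.tsum_add h'
  simp only [Function.comp_def, Equiv.subLeft_apply] at hsum he
  rw [he, ← two_mul] at hsum
  have h2 : ∀ j, (symSymbol l j : ℂ) * (a (l - j) * a j)
      = ((crossSymbol l j : ℂ) * (a (l - j) * a j)
        + (crossSymbol l (l - j) : ℂ) * (a (l - (l - j)) * a (l - j))) / 2 := fun j => by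
    rw [symSymbol, sub_sub_cancel]
    push_cast
    ring
  rw [tsum_congr h2, tsum_div_const, hsum]
  ring

/-- Outside a finite set the multiplier `s` is small and the ℓ¹ norms are uniformly bounded; on the
finite set coordinatewise convergence suffices. -/
lemma tendsto_tsum_mul_of_tendsto {ι α : Type*} {F : Filter α} {s : ι → ℂ}
    (hs : Tendsto s cofinite (𝓝 0)) {b : α → ι → ℂ} {c : ι → ℂ} {M : ℝ}
    (hb : ∀ n, Summable fun j => ‖b n j‖) (hbM : ∀ n, ∑' j, ‖b n j‖ ≤ M)
    (hc : Summable fun j => ‖c j‖) (hbc : ∀ j, Tendsto (fun n => b n j) F (𝓝 (c j))) :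
    Tendsto (fun n => ∑' j, s j * b n j) F (𝓝 (∑' j, s j * c j)) := by
  classical
  set C := ∑' j, ‖c j‖ with hC
  have hC0 : 0 ≤ C := tsum_nonneg fun _ => norm_nonneg _
  rw [Metric.tendsto_nhds]
  intro ε hε
  -- `K` must dominate M + C and be positive; the absolute value is there because `M` carries no
  -- sign.
  set K := |M| + C + 1 with hK
  have hK0 : 0 < K := by positivity
  have hev : ∀ᶠ j in cofinite, ‖s j‖ < ε / (2 * K) := by
    have := hs.norm
    rw [norm_zero] at this
    exact this.eventually_lt_const (by positivity)
  obtain ⟨S, hS⟩ : ∃ S : Finset ι, ∀ j ∉ S, ‖s j‖ ≤ ε / (2 * K) := by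
    have hf : {j | ¬ ‖s j‖ < ε / (2 * K)}.Finite := Filter.eventually_cofinite.1 hev
    refine ⟨hf.toFinset, fun j hj => ?_⟩
    rw [Set.Finite.mem_toFinset, Set.mem_ofPred_eq, not_not] at hj
    exact hj.le
  have hfin : Tendsto (fun n => ∑ j ∈ S, ‖s j‖ * ‖b n j - c j‖) F (𝓝 0) := by
    rw [show (0 : ℝ) = ∑ j ∈ S, ‖s j‖ * 0 by simp]
    refine tendsto_finsetSum _ fun j _ => Tendsto.const_mul _ ?_
    simpa using ((hbc j).sub_const (c j)).norm
  filter_upwards [hfin.eventually_lt_const (half_pos hε)] with n hn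
  have hd : Summable fun j => ‖b n j - c j‖ :=
    ((hb n).add hc).of_nonneg_of_le (fun _ => norm_nonneg _) fun j => norm_sub_le _ _
  have hdC : ∑' j, ‖b n j - c j‖ ≤ M + C :=
    calc ∑' j, ‖b n j - c j‖ ≤ ∑' j, (‖b n j‖ + ‖c j‖) :=
          hd.tsum_le_tsum (fun j => norm_sub_le _ _) ((hb n).add hc)
      _ = _ := (hb n).tsum_add hc
      _ ≤ _ := by gcongr; exact hbM n
  -- Boundedness of `s` is needed only for the summability of the products.
  have hsb : ∃ B, ∀ j, ‖s j‖ ≤ B := by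
    refine ⟨∑ j ∈ S, ‖s j‖ + ε / (2 * K), fun j => ?_⟩
    by_cases hj : j ∈ S
    · have := Finset.single_le_sum (f := fun j => ‖s j‖) (fun _ _ => norm_nonneg _) hj
      have : 0 < ε / (2 * K) := by positivity
      linarith
    · have : 0 ≤ ∑ j ∈ S, ‖s j‖ := Finset.sum_nonneg fun _ _ => norm_nonneg _
      linarith [hS j hj]
  obtain ⟨B, hB⟩ := hsb
  have hmul : ∀ {d : ι → ℂ}, (Summable fun j => ‖d j‖) → Summable fun j => ‖s j * d j‖ :=
    fun {d} hd => (hd.mul_left B).of_nonneg_of_le (fun _ => norm_nonneg _) fun j => by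
      rw [norm_mul]
      exact mul_le_mul_of_nonneg_right (hB j) (norm_nonneg _)
  have h1 : ∑' j, s j * b n j - ∑' j, s j * c j = ∑' j, s j * (b n j - c j) := by
    rw [← (hmul (hb n)).of_norm.tsum_sub (hmul hc).of_norm]
    simp only [mul_sub]
  rw [dist_eq_norm, h1]
  refine (norm_tsum_le_tsum_norm (hmul hd)).trans_lt ?_
  have hs1 : Summable fun j => (if j ∈ S then ‖s j‖ * ‖b n j - c j‖ else 0) :=
    summable_of_hasFiniteSupport ((S.finite_toSet).subset fun j hj => by
      by_contra h
      exact hj (if_neg h))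
  have hs2 := hd.mul_left (ε / (2 * K))
  have hle : ∑' j, ‖s j * (b n j - c j)‖ ≤ ∑' j, ((if j ∈ S then ‖s j‖ * ‖b n j - c j‖ else 0)
      + ε / (2 * K) * ‖b n j - c j‖) := by
    refine (hmul hd).tsum_le_tsum (fun j => ?_) (hs1.add hs2)
    rw [norm_mul]
    split_ifs with hj
    · exact le_add_of_nonneg_right (by positivity)
    · rw [zero_add]
      exact mul_le_mul_of_nonneg_right (hS j hj) (norm_nonneg _)
  rw [hs1.tsum_add hs2, tsum_mul_left, tsum_eq_sum (s := S) (fun j hj => if_neg hj),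
    Finset.sum_congr rfl (fun j hj => if_pos hj)] at hle
  have hlast : ε / (2 * K) * ∑' j, ‖b n j - c j‖ ≤ ε / 2 := by
    calc ε / (2 * K) * ∑' j, ‖b n j - c j‖ ≤ ε / (2 * K) * K := by
          refine mul_le_mul_of_nonneg_left (hdC.trans ?_) (by positivity)
          linarith [le_abs_self M]
      _ = ε / 2 := by field_simp
  linarith

/-- The nonlinearity is continuous under weak convergence in `L²`. -/
lemma tendsto_nonlin {α : Type*} {F : Filter α} {b : α → (Fin 2 → ℤ) → ℂ} {M : ℝ}
    (hb : ∀ n, Summable fun k => ‖b n k‖ ^ 2) (hbM : ∀ n, ∑' k, ‖b n k‖ ^ 2 ≤ M)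
    (ha : Summable fun k => ‖a k‖ ^ 2) (hba : ∀ k, Tendsto (fun n => b n k) F (𝓝 (a k)))
    (l : Fin 2 → ℤ) : Tendsto (fun n => nonlin (b n) l) F (𝓝 (nonlin a l)) := by
  simp only [nonlin_eq_symSymbol ha, fun n => nonlin_eq_symSymbol (hb n)]
  have h := tendsto_tsum_mul_of_tendsto (tendsto_symSymbol l)
    (fun n => (summable_norm_mul_sub (hb n) l).1)
    (fun n => (summable_norm_mul_sub (hb n) l).2.trans (hbM n))
    (summable_norm_mul_sub ha l).1 fun j => (hba (l - j)).mul (hba j)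
  exact h.const_mul _

/-- The trilinear form of the energy balance. -/
def energyTerm (a : (Fin 2 → ℤ) → ℂ) (p : (Fin 2 → ℤ) × (Fin 2 → ℤ)) : ℂ :=
  (crossSymbol p.1 p.2 : ℂ) * (a (p.1 - p.2) * a p.2) * conj (a p.1)

/-- The shear `(l, j) ↦ (l - j, j)` of pairs of wave vectors. -/
def shear : (Fin 2 → ℤ) × (Fin 2 → ℤ) ≃ (Fin 2 → ℤ) × (Fin 2 → ℤ) where
  toFun p := (p.1 - p.2, p.2)
  invFun p := (p.1 + p.2, p.2)
  left_inv p := by simp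
  right_inv p := by simp

/-- The involution `(l, j) ↦ (j - l, j)` of pairs of wave vectors. -/
def freqFlip : (Fin 2 → ℤ) × (Fin 2 → ℤ) ≃ (Fin 2 → ℤ) × (Fin 2 → ℤ) where
  toFun p := (p.2 - p.1, p.2)
  invFun p := (p.2 - p.1, p.2)
  left_inv p := by simp
  right_inv p := by simp

/-- Write |l||a(l−j)||a(j)||a(l)| as the product of (|l−j||a(l−j)|)(|j||a(j)|) and
|l||a(l)|/(|j||l−j|), use XY ≤ X² + Y², and split the inverse powers by x²y² ≤ x⁴ + y⁴. Every
resulting term is summable over pairs for an H¹ function, since Σ|k|⁻⁴ converges on a lattice of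
rank two. The condition a(0) = 0 removes the frequencies where the division fails. -/
lemma norm_energyTerm_le (h0 : a 0 = 0) (l j : Fin 2 → ℤ) :
    ‖energyTerm a (l, j)‖ ≤ (freqNorm (l - j) * ‖a (l - j)‖) ^ 2 * (freqNorm j * ‖a j‖) ^ 2
      + ((freqNorm l * ‖a l‖) ^ 2 * (freqNorm j ^ 4)⁻¹
        + (freqNorm l * ‖a l‖) ^ 2 * (freqNorm (l - j) ^ 4)⁻¹) := by
  have hnn : 0 ≤ (freqNorm (l - j) * ‖a (l - j)‖) ^ 2 * (freqNorm j * ‖a j‖) ^ 2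
      + ((freqNorm l * ‖a l‖) ^ 2 * (freqNorm j ^ 4)⁻¹
        + (freqNorm l * ‖a l‖) ^ 2 * (freqNorm (l - j) ^ 4)⁻¹) := by
    have := freqNorm_nonneg j
    have := freqNorm_nonneg (l - j)
    positivity
  rcases eq_or_ne j 0 with rfl | hj
  · have : energyTerm a (l, 0) = 0 := by simp only [energyTerm, h0, mul_zero, zero_mul]
    rw [this, norm_zero]
    exact hnn
  rcases eq_or_ne (l - j) 0 with hlj | hlj
  · have : energyTerm a (l, j) = 0 := by simp only [energyTerm, hlj, h0, mul_zero, zero_mul]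
    rw [this, norm_zero]
    exact hnn
  have hj' := freqNorm_pos hj
  have hlj' := freqNorm_pos hlj
  have key : ∀ p q r u v w : ℝ, 0 < p → 0 < q →
      r * (u * v) * w ≤ (q * u) ^ 2 * (p * v) ^ 2
        + ((r * w) ^ 2 * (p ^ 4)⁻¹ + (r * w) ^ 2 * (q ^ 4)⁻¹) := by
    intro p q r u v w hp hq
    have hx : p * p⁻¹ = 1 := mul_inv_cancel₀ hp.ne'
    have hy : q * q⁻¹ = 1 := mul_inv_cancel₀ hq.ne'
    rw [← inv_pow, ← inv_pow]
    set x := p⁻¹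
    set y := q⁻¹
    have e : r * (u * v) * w = ((q * u) * (p * v)) * ((r * w) * (x * y)) := by
      linear_combination (-(r * u * v * w)) * hx - (r * u * v * w * (p * x)) * hy
    rw [e]
    have h1 : ((q * u) * (p * v)) * ((r * w) * (x * y))
        ≤ ((q * u) * (p * v)) ^ 2 + ((r * w) * (x * y)) ^ 2 := by
      nlinarith [sq_nonneg ((q * u) * (p * v) - (r * w) * (x * y)),
        sq_nonneg ((q * u) * (p * v)), sq_nonneg ((r * w) * (x * y))]
    have h2 : (x * y) ^ 2 ≤ x ^ 4 + y ^ 4 := by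
      nlinarith [sq_nonneg (x ^ 2 - y ^ 2), sq_nonneg (x ^ 2), sq_nonneg (y ^ 2)]
    have h3 := mul_le_mul_of_nonneg_left h2 (sq_nonneg (r * w))
    rw [mul_pow, mul_pow (r * w)] at h1
    linarith
  refine le_trans ?_ (key _ _ _ _ _ _ hj' hlj')
  rw [energyTerm, norm_mul, norm_mul, norm_mul, Complex.norm_real, RCLike.norm_conj]
  exact mul_le_mul_of_nonneg_right (mul_le_mul_of_nonneg_right (abs_crossSymbol_le l j)
    (mul_nonneg (norm_nonneg _) (norm_nonneg _))) (norm_nonneg _)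

lemma summable_convolution_weights {b w : (Fin 2 → ℤ) → ℝ} (hb : Summable fun k => b k ^ 2)
    (hw : Summable w) (hw0 : ∀ k, 0 ≤ w k) :
    Summable fun p : (Fin 2 → ℤ) × (Fin 2 → ℤ) => b (p.1 - p.2) ^ 2 * b p.2 ^ 2
      + (b p.1 ^ 2 * w p.2 + b p.1 ^ 2 * w (p.1 - p.2)) := by
  have hbb := hb.mul_of_nonneg hb (fun _ => sq_nonneg _) (fun _ => sq_nonneg _)
  have hbw := hb.mul_of_nonneg hw (fun _ => sq_nonneg _) hw0
  let e : (Fin 2 → ℤ) × (Fin 2 → ℤ) ≃ (Fin 2 → ℤ) × (Fin 2 → ℤ) :=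
    { toFun := fun p => (p.1, p.1 - p.2)
      invFun := fun p => (p.1, p.1 - p.2)
      left_inv := fun p => by simp
      right_inv := fun p => by simp }
  -- The changes of variables (l, j) ↦ (l−j, j) and (l, j) ↦ (l, l−j) reduce each term to a product
  -- of two independent summable families.
  have h1 := hbb.comp_injective shear.injective
  have h2 := hbw.comp_injective e.injective
  have h3 := h1.add (hbw.add h2)
  exact h3

lemma summable_energyTerm (h0 : a 0 = 0)
    (ha : Summable fun k => freqNorm k ^ 2 * ‖a k‖ ^ 2) : Summable (energyTerm a) := by
  have hs := summable_convolution_weights (b := fun k => freqNorm k * ‖a k‖)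
    (w := fun k => (freqNorm k ^ 4)⁻¹) (ha.congr fun k => (mul_pow _ _ _).symm)
    (summable_freqNorm_inv_pow (by norm_num))
    (fun k => inv_nonneg.2 (pow_nonneg (freqNorm_nonneg k) _))
  exact Summable.of_norm_bounded hs fun p => norm_energyTerm_le h0 p.1 p.2

/-- Fourier form of ∫ θ v·∇θ = 0. Under (l, j) ↦ (j−l, j) the cross product changes sign, while conj
a(k) = a(−k) leaves the triple product of coefficients unchanged; the absolutely convergent double
sum equals its own negative. -/
lemma hasSum_nonlin_mul_conj (h0 : a 0 = 0) (hconj : ∀ k, a (-k) = conj (a k))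
    (ha : Summable fun k => freqNorm k ^ 2 * ‖a k‖ ^ 2) :
    HasSum (fun l => nonlin a l * conj (a l)) 0 := by
  have hs := summable_energyTerm h0 ha
  have hflip : ∀ p, energyTerm a (freqFlip p) = - energyTerm a p := fun p => by
    obtain ⟨l, j⟩ := p
    simp only [energyTerm, freqFlip, Equiv.coe_fn_mk, crossSymbol, cross_sub_left]
    rw [show j - l - j = -l by abel, hconj l, ← hconj (j - l), neg_sub]
    push_cast
    ring
  have hz : ∑' p, energyTerm a p = 0 := by
    have h := freqFlip.tsum_eq (energyTerm a)
    simp only [hflip, tsum_neg] at h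
    linear_combination (-1 / 2 : ℂ) * h
  have hsum := hs.hasSum
  rw [hz] at hsum
  have h1 := hsum.prod_fiberwise fun l => (hs.prod_factor l).hasSum
  have h := h1.mul_left (2 * Real.pi : ℂ)
  rw [mul_zero] at h
  have h2 : ∀ l, nonlin a l * conj (a l) = 2 * Real.pi * ∑' j, energyTerm a (l, j) := fun l => by
    simp only [energyTerm, nonlin]
    rw [tsum_mul_right, mul_assoc]
  simpa only [h2] using h

end Nonlinearity

/-! ### Mode equations and energy conservation for the regularized problem. -/

section RegularizedModes

/-- The integral is the coordinate of the n-th basis vector along the constant one in the Fourier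
Hilbert basis. -/
lemma integral_mFourier (n : Fin 2 → ℤ) :
    ∫ x, mFourier n x ∂torusMeasure = if n = 0 then 1 else 0 := by
  have h := mFourierBasis_repr (d := Fin 2) (mFourierBasis n) 0
  rw [HilbertBasis.repr_self, coe_mFourierBasis, mFourierLp, mFourierCoeff_toLp,
    lp.single_apply] at h
  simp only [mFourierCoeff, neg_zero, mFourier_zero, ContinuousMap.one_apply, one_smul] at h
  refine Eq.trans (Eq.symm h) ?_
  by_cases hn : n = 0
  · subst hn
    simp
  · rw [if_neg hn, Pi.single_eq_of_ne (Ne.symm hn)]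

/-- The real trigonometric polynomial `Re (z exp(-2πi l·x))`. -/
def trig (z : ℂ) (l : Fin 2 → ℤ) (x : Torus) : ℝ := (z * mFourier (-l) x).re

lemma continuous_trig (z : ℂ) (l : Fin 2 → ℤ) : Continuous (trig z l) :=
  Complex.continuous_re.comp (continuous_const.mul (ContinuousMap.continuous _))

lemma memLp_trig (z : ℂ) (l : Fin 2 → ℤ) : MemLp (trig z l) 2 torusMeasure := by
  refine MemLp.of_bound (continuous_trig z l).aestronglyMeasurable ‖z‖
    (Eventually.of_forall fun x => ?_)
  rw [Real.norm_eq_abs]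
  refine (Complex.abs_re_le_norm _).trans (le_of_eq ?_)
  rw [norm_mul, norm_mFourier_apply, mul_one]

lemma integrable_mFourier_mul {f : Torus → ℝ} (hf : Integrable f torusMeasure)
    (l : Fin 2 → ℤ) : Integrable (fun x => mFourier l x * (f x : ℂ)) torusMeasure := by
  refine (Integrable.ofReal hf).bdd_mul (c := 1)
    (ContinuousMap.continuous _).aestronglyMeasurable (Eventually.of_forall fun x => ?_)
  exact (norm_mFourier_apply l x).le

lemma integral_mul_trig {f : Torus → ℝ} (hf : Integrable f torusMeasure) (z : ℂ)
    (l : Fin 2 → ℤ) : ∫ x, f x * trig z l x ∂torusMeasure = (z * fourierC f l).re := by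
  rw [fourierC_eq, ← integral_const_mul]
  refine Eq.trans ?_ (integral_re ((integrable_mFourier_mul hf (-l)).const_mul z))
  refine integral_congr_ae (Eventually.of_forall fun x => ?_)
  simp only [trig]
  rw [← mul_assoc, RCLike.re_eq_complex_re, Complex.re_mul_ofReal, mul_comm]

lemma fourierC_trig (z : ℂ) (l k : Fin 2 → ℤ) :
    fourierC (trig z l) k
      = (z * (if k = -l then 1 else 0) + conj z * (if k = l then 1 else 0)) / 2 := by
  have hi : ∀ n : Fin 2 → ℤ, Integrable (fun x => mFourier n x) torusMeasure := fun n =>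
    (ContinuousMap.continuous (mFourier n)).integrable_of_hasCompactSupport
      (HasCompactSupport.of_compactSpace _)
  have h1 : ∀ x, mFourier (-k) x * (trig z l x : ℂ)
      = z / 2 * mFourier (-k - l) x + conj z / 2 * mFourier (l - k) x := fun x => by
    rw [trig, Complex.re_eq_add_conj, map_mul, ← mFourier_neg, neg_neg, sub_eq_add_neg,
      sub_eq_add_neg, mFourier_add, mFourier_add]
    ring
  rw [fourierC_eq, integral_congr_ae (Eventually.of_forall h1),
    integral_add ((hi _).const_mul _) ((hi _).const_mul _), integral_const_mul,
    integral_const_mul, integral_mFourier, integral_mFourier]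
  have e1 : (-k - l = 0) ↔ k = -l := by
    rw [sub_eq_zero, neg_eq_iff_eq_neg]
  have e2 : (l - k = 0) ↔ k = l := by
    rw [sub_eq_zero, eq_comm]
  simp only [e1, e2]
  ring

/-- `Re (z exp(-2πi l·x))`, for `l ≠ 0`, as an element of `Ḣ¹(Ω)`. -/
def trigH1 (z : ℂ) (l : Fin 2 → ℤ) (hl : l ≠ 0) : H1dot :=
  ⟨WithLp.toLp 2 ((memLp_trig z l).toLp _, WithLp.toLp 2 fun i =>
    (memLp_trig (-(2 * Real.pi * Complex.I * (l i : ℂ)) * z) l).toLp _), by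
    refine ⟨?_, fun i k => ?_⟩
    · change ∫ x, ((memLp_trig z l).toLp _ : L2) x ∂torusMeasure = 0
      rw [integral_congr_ae (memLp_trig z l).coeFn_toLp, ← fourierC_zero_index_eq_zero_iff,
        fourierC_trig, if_neg (by rwa [eq_comm, neg_eq_zero]), if_neg (Ne.symm hl)]
      simp
    · change fourierC ((memLp_trig _ l).toLp _ : L2) k
        = _ * fourierC ((memLp_trig z l).toLp _ : L2) k
      rw [fourierC_congr (memLp_trig z l).coeFn_toLp, fourierC_congr (MemLp.coeFn_toLp _),
        fourierC_trig, fourierC_trig]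
      by_cases h1 : k = -l
      · by_cases h2 : k = l
        · exfalso
          apply hl
          rw [h2] at h1
          exact self_eq_neg.1 h1
        · rw [if_pos h1, if_neg h2, h1]
          simp
          ring
      · by_cases h2 : k = l
        · rw [if_neg h1, if_pos h2, h2]
          simp [map_ofNat]
          ring
        · rw [if_neg h1, if_neg h2]
          simp⟩

lemma h1Val_trigH1 (z : ℂ) (l : Fin 2 → ℤ) (hl : l ≠ 0) :
    h1Val (trigH1 z l hl) =ᵐ[torusMeasure] trig z l := (memLp_trig z l).coeFn_toLp

lemma h1Grad_trigH1 (z : ℂ) (l : Fin 2 → ℤ) (hl : l ≠ 0) (i : Fin 2) :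
    h1Grad (trigH1 z l hl) i =ᵐ[torusMeasure]
      trig (-(2 * Real.pi * Complex.I * (l i : ℂ)) * z) l := (memLp_trig _ l).coeFn_toLp

lemma fourierC_h1Grad (u : H1dot) (i : Fin 2) (k : Fin 2 → ℤ) :
    fourierC (h1Grad u i) k = 2 * Real.pi * Complex.I * (k i : ℂ) * fourierC (h1Val u) k :=
  u.2.2 i k

lemma fourierC_h1Val_zero (u : H1dot) : fourierC (h1Val u) 0 = 0 :=
  (fourierC_zero_index_eq_zero_iff _).2 u.2.1

/-- `-div(vθ)` has the Fourier coefficients `nonlin θ̂`. -/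
lemma sum_fourierC_mul_eq_nonlin {f ψ : Torus → ℝ} {v : Fin 2 → Torus → ℝ}
    (hf : MemLp f 2 torusMeasure) (hv : ∀ i, MemLp (v i) 2 torusMeasure)
    (hψ : IsStreamFunction f ψ) (hvψ : IsPerpGrad ψ v) (l : Fin 2 → ℤ) :
    ∑ i, -(2 * Real.pi * Complex.I * (l i : ℂ)) * fourierC (fun x => f x * v i x) l
      = nonlin (fourierC f) l := by
  have h := hasSum_sum fun i (_ : i ∈ Finset.univ) =>
    (hasSum_fourierC_conv hf (hv i) l).mul_left (-(2 * Real.pi * Complex.I * (l i : ℂ)))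
  refine h.unique ?_
  have hs := ((summable_crossSymbol_mul (hasSum_fourierC_sq hf).summable l).of_norm.hasSum).mul_left
    (2 * Real.pi : ℂ)
  rw [← nonlin] at hs
  convert hs using 2 with j
  have h0 : fourierC (v 0) j = -(2 * Real.pi * Complex.I * (j 1 : ℂ) * fourierC ψ j) := by
    have := hvψ.1 j
    rw [fourierC_neg] at this
    rw [← this, neg_neg]
  have h1 := hvψ.2 j
  rw [Fin.sum_univ_two, h0, h1]
  have hψj := hψ.1 j
  rw [← freqNorm] at hψj
  rcases eq_or_ne j 0 with rfl | hj
  · simp [crossSymbol, freqNorm_zero]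
  · have hj' : (freqNorm j : ℂ) ≠ 0 := by exact_mod_cast (freqNorm_pos hj).ne'
    rw [← hψj, crossSymbol, cross]
    push_cast
    have hI := Complex.I_sq
    field_simp
    linear_combination (-fourierC f (l - j) * fourierC ψ j
      * ((l 1 : ℂ) * j 0 - l 0 * j 1)) * hI

variable {α : ℝ} {θ₀ : H1dot} {θ : ℝ → H1dot}

/-- The regularized equation for a single Fourier mode. -/
lemma IsRegularizedSolution.mode_eq (h : IsRegularizedSolution α θ₀ θ) (t : ℝ)
    (l : Fin 2 → ℤ) :
    ((1 + α ^ 2 * (2 * Real.pi * freqNorm l) ^ 2 : ℝ) : ℂ) * fourierC (h1Val (deriv θ t)) l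
      = nonlin (fourierC (h1Val (θ t))) l := by
  -- Constants do not lie in Ḣ¹, so the mode `l = 0` cannot be tested; there both sides vanish.
  rcases eq_or_ne l 0 with rfl | hl
  · rw [fourierC_h1Val_zero, nonlin_zero_index, mul_zero]
  obtain ⟨ψ, v, hψ, hv, heq⟩ := h.evolution t
  have hL2 : ∀ f : L2, Integrable f torusMeasure := fun f =>
    (Lp.memLp f).integrable (by norm_num)
  -- Test functions are real, so each yields only the real part of `z` times the identity. The
  -- choices `z = 1` and `z = -I` recover both parts.
  have key : ∀ z : ℂ, (z * (((1 + α ^ 2 * (2 * Real.pi * freqNorm l) ^ 2 : ℝ) : ℂ)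
      * fourierC (h1Val (deriv θ t)) l)).re = (z * nonlin (fourierC (h1Val (θ t))) l).re := by
    intro z
    have h1 := heq (trigH1 z l hl)
    have e1 : ∫ x, h1Val (deriv θ t) x * h1Val (trigH1 z l hl) x ∂torusMeasure
        = (z * fourierC (h1Val (deriv θ t)) l).re := by
      rw [← integral_mul_trig (hL2 _)]
      refine integral_congr_ae ?_
      filter_upwards [h1Val_trigH1 z l hl] with x hx
      rw [hx]
    have e2 : ∀ i, ∫ x, h1Grad (deriv θ t) i x * h1Grad (trigH1 z l hl) i x ∂torusMeasure
        = ((2 * Real.pi * (l i : ℝ)) ^ 2 : ℝ) * (z * fourierC (h1Val (deriv θ t)) l).re := by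
      intro i
      rw [← Complex.re_ofReal_mul, integral_congr_ae (g := fun x => h1Grad (deriv θ t) i x *
        trig (-(2 * Real.pi * Complex.I * (l i : ℂ)) * z) l x), integral_mul_trig (hL2 _),
        fourierC_h1Grad]
      · congr 1
        push_cast
        linear_combination (-4 * (Real.pi : ℂ) ^ 2 * (l i : ℂ) ^ 2 * z
          * fourierC (h1Val (deriv θ t)) l) * Complex.I_sq
      · filter_upwards [h1Grad_trigH1 z l hl i] with x hx
        rw [hx]
    have hvi : ∀ i, Integrable (fun x => h1Val (θ t) x * v i x) torusMeasure := fun i =>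
      (Lp.memLp (h1Val (θ t))).integrable_mul (Lp.memLp (v i))
    have e3 : ∫ x, h1Val (θ t) x * ∑ i, v i x * h1Grad (trigH1 z l hl) i x ∂torusMeasure
        = (z * nonlin (fourierC (h1Val (θ t))) l).re := by
      rw [← sum_fourierC_mul_eq_nonlin (Lp.memLp _) (fun i => Lp.memLp (v i)) hψ hv l,
        Finset.mul_sum, Complex.re_sum]
      have e4 : ∀ i, (z * (-(2 * Real.pi * Complex.I * (l i : ℂ))
          * fourierC (fun x => h1Val (θ t) x * v i x) l)).re
          = ∫ x, (h1Val (θ t) x * v i x)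
            * trig (-(2 * Real.pi * Complex.I * (l i : ℂ)) * z) l x ∂torusMeasure := fun i => by
        rw [integral_mul_trig (hvi i)]
        congr 1
        ring
      rw [Finset.sum_congr rfl fun i _ => e4 i, ← integral_finsetSum]
      · refine integral_congr_ae ?_
        filter_upwards [h1Grad_trigH1 z l hl 0, h1Grad_trigH1 z l hl 1] with x hx0 hx1
        simp only [Fin.sum_univ_two]
        rw [hx0, hx1]
        ring
      · intro i _
        refine (hvi i).mul_bdd (c := ‖(-(2 * Real.pi * Complex.I * (l i : ℂ)) * z)‖)
          (continuous_trig _ _).aestronglyMeasurable (Eventually.of_forall fun x => ?_)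
        rw [Real.norm_eq_abs]
        refine (Complex.abs_re_le_norm _).trans (le_of_eq ?_)
        rw [norm_mul, norm_mFourier_apply, mul_one]
    rw [e1, e3, Finset.sum_congr rfl fun i _ => e2 i, Fin.sum_univ_two] at h1
    rw [← h1, mul_left_comm, Complex.re_ofReal_mul, mul_pow _ (freqNorm l), freqNorm_sq]
    ring
  have k1 := key 1
  have k2 := key (-Complex.I)
  rw [one_mul, one_mul] at k1
  refine Complex.ext k1 ?_
  simpa using k2

/-- The value map `Ḣ¹(Ω) → L²(Ω)` as a continuous linear map. -/
def h1ValCLM : H1dot →L[ℝ] L2 :=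
  (WithLp.fstL 2 ℝ L2 (PiLp 2 (fun _ : Fin 2 => L2))).comp H1dot.subtypeL

/-- The `i`-th partial derivative `Ḣ¹(Ω) → L²(Ω)` as a continuous linear map. -/
def h1GradCLM (i : Fin 2) : H1dot →L[ℝ] L2 :=
  (PiLp.proj 2 (fun _ : Fin 2 => L2) i : PiLp 2 (fun _ : Fin 2 => L2) →L[ℝ] L2).comp
    ((WithLp.sndL 2 ℝ L2 (PiLp 2 (fun _ : Fin 2 => L2))).comp H1dot.subtypeL)

lemma IsRegularizedSolution.hasDerivAt (h : IsRegularizedSolution α θ₀ θ) (t : ℝ) :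
    HasDerivAt θ (deriv θ t) t :=
  (h.contDiff.differentiable (by norm_num) t).hasDerivAt

lemma IsRegularizedSolution.hasDerivAt_fourierC (h : IsRegularizedSolution α θ₀ θ)
    (l : Fin 2 → ℤ) (t : ℝ) :
    HasDerivAt (fun s => fourierC (h1Val (θ s)) l) (fourierC (h1Val (deriv θ t)) l) t :=
  ((fourierCLM l).comp h1ValCLM).hasFDerivAt.comp_hasDerivAt t (h.hasDerivAt t)

/-- The energy `‖u‖² + α² ‖∇u‖²`. -/
def energy (α : ℝ) (u : H1dot) : ℝ := ‖h1Val u‖ ^ 2 + α ^ 2 * ∑ i, ‖h1Grad u i‖ ^ 2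

lemma summable_freqNorm_sq_mul (u : H1dot) :
    Summable fun k => freqNorm k ^ 2 * ‖fourierC (h1Val u) k‖ ^ 2 := by
  have h := (hasSum_sum fun i (_ : i ∈ Finset.univ) =>
    hasSum_fourierC_L2_sq (h1Grad u i)).summable.mul_left ((2 * Real.pi) ^ 2)⁻¹
  refine h.congr fun k => ?_
  rw [Fin.sum_univ_two, fourierC_h1Grad, fourierC_h1Grad, freqNorm_sq]
  simp only [norm_mul, Complex.norm_real, Complex.norm_I, Complex.norm_intCast,
    Complex.norm_ofNat, Real.norm_of_nonneg Real.pi_pos.le, mul_one, mul_pow, sq_abs]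
  have := Real.pi_pos.ne'
  field_simp

/-- By Parseval and the mode equations the time derivative of the energy is twice the sum of
N(θ̂)(l) conj θ̂(l), which vanishes. That θ(t) lies in H¹ is what makes this sum absolutely
convergent. -/
lemma IsRegularizedSolution.energy_eq (h : IsRegularizedSolution α θ₀ θ) (t : ℝ) :
    energy α (θ t) = energy α θ₀ := by
  have hd : ∀ s, HasDerivAt (fun s => energy α (θ s)) 0 s := by
    intro s
    have d0 : HasDerivAt (fun s => h1Val (θ s)) (h1Val (deriv θ s)) s :=
      h1ValCLM.hasFDerivAt.comp_hasDerivAt s (h.hasDerivAt s)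
    have d1 : ∀ i, HasDerivAt (fun s => h1Grad (θ s) i) (h1Grad (deriv θ s) i) s := fun i =>
      (h1GradCLM i).hasFDerivAt.comp_hasDerivAt s (h.hasDerivAt s)
    have hE := d0.norm_sq.add ((HasDerivAt.fun_sum fun i (_ : i ∈ Finset.univ) =>
      (d1 i).norm_sq).const_mul (α ^ 2))
    have hz : inner ℝ (h1Val (θ s)) (h1Val (deriv θ s))
        + α ^ 2 * ∑ i, inner ℝ (h1Grad (θ s) i) (h1Grad (deriv θ s) i) = 0 := by
      have s0 := hasSum_fourierC_inner (h1Val (θ s)) (h1Val (deriv θ s))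
      have s1 := (hasSum_sum fun i (_ : i ∈ Finset.univ) =>
        hasSum_fourierC_inner (h1Grad (θ s) i) (h1Grad (deriv θ s) i)).mul_left ((α : ℂ) ^ 2)
      have s2 := hasSum_nonlin_mul_conj (fourierC_h1Val_zero (θ s))
        (fourierC_neg_index (h1Val (θ s))) (summable_freqNorm_sq_mul (θ s))
      have s3 : ∀ l, conj (fourierC (h1Val (θ s)) l) * fourierC (h1Val (deriv θ s)) l
          + (α : ℂ) ^ 2 * ∑ i, conj (fourierC (h1Grad (θ s) i) l)
            * fourierC (h1Grad (deriv θ s) i) l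
          = nonlin (fourierC (h1Val (θ s))) l * conj (fourierC (h1Val (θ s)) l) := fun l => by
        rw [← h.mode_eq s l]
        simp only [fourierC_h1Grad, Fin.sum_univ_two, map_mul, Complex.conj_I,
          Complex.conj_ofReal, map_ofNat, map_intCast]
        rw [mul_pow _ (freqNorm l), freqNorm_sq]
        push_cast
        linear_combination (-4 * (α : ℂ) ^ 2 * (Real.pi : ℂ) ^ 2
          * ((l 0 : ℂ) ^ 2 + (l 1 : ℂ) ^ 2) * conj (fourierC (h1Val (θ s)) l)
          * fourierC (h1Val (deriv θ s)) l) * Complex.I_sq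
      have s4 := s0.add s1
      simp only [s3] at s4
      have s5 := s4.unique s2
      exact_mod_cast s5
    refine hE.congr_deriv ?_
    rw [← Finset.mul_sum]
    linear_combination (2 : ℝ) * hz
  have := is_const_of_deriv_eq_zero (fun s => (hd s).differentiableAt) (fun s => (hd s).deriv) t 0
  rw [this, h.initial]

lemma IsRegularizedSolution.norm_sq_le (h : IsRegularizedSolution α θ₀ θ) (t : ℝ) :
    ‖h1Val (θ t)‖ ^ 2 ≤ energy α θ₀ := by
  rw [← h.energy_eq t, energy]
  exact le_add_of_nonneg_right (by positivity)

lemma energy_mono {α β : ℝ} (h0 : 0 ≤ α) (h : α ≤ β) (u : H1dot) : energy α u ≤ energy β u := by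
  unfold energy
  gcongr

end RegularizedModes

/-! ### Space-time functions: slices, time-localized modes, reconstruction from coefficients. -/

section SpaceTime

variable {T : ℝ}

/-- Lebesgue measure on the time interval `(-T, T)`. -/
abbrev timeMeasure (T : ℝ) : Measure ℝ := (volume : Measure ℝ).restrict (Ioo (-T) T)

lemma ae_slice_of_ae_prod {p : Torus × ℝ → Prop} (h : ∀ᵐ q ∂(spaceTimeMeasure T), p q) :
    ∀ᵐ t ∂(timeMeasure T), ∀ᵐ x ∂torusMeasure, p (x, t) := by
  have h1 : ∀ᵐ q ∂((timeMeasure T).prod torusMeasure), p q.swap :=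
    Measure.measurePreserving_swap.quasiMeasurePreserving.ae h
  exact Measure.ae_ae_of_ae_prod h1

lemma memLp_slice {E : Type*} [NormedAddCommGroup E] {F : Torus × ℝ → E}
    (hF : MemLp F 2 (spaceTimeMeasure T)) :
    ∀ᵐ t ∂(timeMeasure T), MemLp (fun x => F (x, t)) 2 torusMeasure := by
  have h := (memLp_two_iff_integrable_sq_norm hF.1).1 hF
  filter_upwards [h.prod_left_ae, hF.1.prodMk_right] with t h1 h2
  exact (memLp_two_iff_integrable_sq_norm h2).2 h1

lemma memLp_L2ST_slice (u : L2ST T) :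
    ∀ᵐ t ∂(timeMeasure T), MemLp (fun x => u (x, t)) 2 torusMeasure :=
  memLp_slice (Lp.memLp u)

lemma L2ST_norm_sq (u : L2ST T) :
    ‖u‖ ^ 2 = ∫ t, (∫ x, u (x, t) ^ 2 ∂torusMeasure) ∂(timeMeasure T) := by
  rw [← integral_prod_symm (fun p => u p ^ 2) (Lp.memLp u).integrable_sq,
    ← real_inner_self_eq_norm_sq, L2.inner_def]
  simp [sq]

lemma integrable_slice_sq (u : L2ST T) :
    Integrable (fun t => ∫ x, u (x, t) ^ 2 ∂torusMeasure) (timeMeasure T) :=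
  (Lp.memLp u).integrable_sq.integral_prod_right

/-- The space-time function `1_A(t) exp(2πi m·x)`. -/
def cutMode (A : Set ℝ) (m : Fin 2 → ℤ) (p : Torus × ℝ) : ℂ :=
  mFourier m p.1 * A.indicator (fun _ => (1 : ℂ)) p.2

lemma norm_cutMode_le (A : Set ℝ) (m : Fin 2 → ℤ) (p : Torus × ℝ) : ‖cutMode A m p‖ ≤ 1 := by
  rw [cutMode, norm_mul, norm_mFourier_apply, one_mul]
  exact (norm_indicator_le_norm_self _ _).trans (by simp)

lemma aestronglyMeasurable_cutMode {A : Set ℝ} (hA : MeasurableSet A) (m : Fin 2 → ℤ) :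
    AEStronglyMeasurable (cutMode A m) (spaceTimeMeasure T) :=
  ((ContinuousMap.continuous (mFourier m)).comp continuous_fst).aestronglyMeasurable.mul
    (((stronglyMeasurable_const.indicator hA).aestronglyMeasurable (μ := timeMeasure T)).comp_snd)

lemma memLp_cutMode {A : Set ℝ} (hA : MeasurableSet A) (m : Fin 2 → ℤ) :
    MemLp (cutMode A m) 2 (spaceTimeMeasure T) :=
  MemLp.of_bound (aestronglyMeasurable_cutMode hA m) 1 (Eventually.of_forall (norm_cutMode_le A m))

lemma integral_cutMode_mul {F : Torus × ℝ → ℂ} (hF : Integrable F (spaceTimeMeasure T))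
    {A : Set ℝ} (hA : MeasurableSet A) (m : Fin 2 → ℤ) :
    ∫ p, cutMode A (-m) p * F p ∂(spaceTimeMeasure T)
      = ∫ t in A, mFourierCoeff (fun x => F (x, t)) m ∂(timeMeasure T) := by
  have hi : Integrable (fun p => cutMode A (-m) p * F p) (spaceTimeMeasure T) :=
    hF.bdd_mul (c := 1) (aestronglyMeasurable_cutMode hA _)
      (Eventually.of_forall (norm_cutMode_le A _))
  rw [integral_prod_symm _ hi, ← integral_indicator hA]
  refine integral_congr_ae (Eventually.of_forall fun t => ?_)
  by_cases ht : t ∈ A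
  · simp only [cutMode, indicator_of_mem ht, mul_one, mFourierCoeff, smul_eq_mul]
    rfl
  · simp only [cutMode, indicator_of_notMem ht, mul_zero, zero_mul, integral_zero]

lemma integrable_mFourierCoeff_slice {F : Torus × ℝ → ℂ}
    (hF : Integrable F (spaceTimeMeasure T)) (m : Fin 2 → ℤ) :
    Integrable (fun t => mFourierCoeff (fun x => F (x, t)) m) (timeMeasure T) := by
  have hi : Integrable (fun p => mFourier (-m) p.1 * F p) (spaceTimeMeasure T) :=
    hF.bdd_mul (c := 1)
      ((ContinuousMap.continuous (mFourier (-m))).comp continuous_fst).aestronglyMeasurable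
      (Eventually.of_forall fun p => (norm_mFourier_apply _ _).le)
  exact hi.integral_prod_right

lemma integrable_of_memLp_two {E : Type*} [NormedAddCommGroup E] {F : Torus × ℝ → E}
    (hF : MemLp F 2 (spaceTimeMeasure T)) : Integrable F (spaceTimeMeasure T) :=
  hF.integrable (by norm_num)

lemma integrable_fourierC_slice (u : L2ST T) (m : Fin 2 → ℤ) :
    Integrable (fun t => fourierC (fun x => u (x, t)) m) (timeMeasure T) :=
  integrable_mFourierCoeff_slice (integrable_of_memLp_two (memLp_ofReal (Lp.memLp u))) m

/-- Time integrals of the Fourier coefficients of the slices are continuous functionals on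
`L²(Ω × (-T, T))`. -/
lemma exists_inner_eq_setIntegral_fourierC {A : Set ℝ} (hA : MeasurableSet A) (m : Fin 2 → ℤ)
    (z : ℂ) : ∃ g : L2ST T, ∀ u : L2ST T, inner ℝ g u
      = (z * ∫ t in A, fourierC (fun x => u (x, t)) m ∂(timeMeasure T)).re := by
  have hg : MemLp (fun p => (z * cutMode A (-m) p).re) 2 (spaceTimeMeasure T) :=
    ((memLp_cutMode hA (-m)).const_mul z).re
  refine ⟨hg.toLp _, fun u => ?_⟩
  have hu := integrable_of_memLp_two (memLp_ofReal (Lp.memLp u))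
  have hi : Integrable (fun p => z * (cutMode A (-m) p * (u p : ℂ))) (spaceTimeMeasure T) :=
    (hu.bdd_mul (c := 1) (aestronglyMeasurable_cutMode hA _)
      (Eventually.of_forall (norm_cutMode_le A _))).const_mul z
  have h1 := integral_cutMode_mul hu hA m
  change _ = (z * ∫ t in A, mFourierCoeff (fun x => (u (x, t) : ℂ)) m ∂(timeMeasure T)).re
  rw [← h1, ← integral_const_mul, L2.inner_def]
  refine Eq.trans ?_ (integral_re hi)
  refine integral_congr_ae ?_
  filter_upwards [hg.coeFn_toLp] with p hp
  rw [hp, ← mul_assoc, RCLike.re_eq_complex_re, Complex.re_mul_ofReal]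
  simp [mul_comm]

/-- A space-time function with prescribed Fourier coefficients in space. -/
lemma exists_memLp_of_coeffs {c : (Fin 2 → ℤ) → ℝ → ℂ} {G : ℝ → ℝ}
    (hm : ∀ k, AEStronglyMeasurable (c k) (timeMeasure T)) (hG : Integrable G (timeMeasure T))
    (hcG : ∀ᵐ t ∂(timeMeasure T), ∀ S : Finset (Fin 2 → ℤ), ∑ k ∈ S, ‖c k t‖ ^ 2 ≤ G t) :
    ∃ U : Torus × ℝ → ℂ, MemLp U 2 (spaceTimeMeasure T) ∧
      ∀ᵐ t ∂(timeMeasure T), ∀ k, mFourierCoeff (fun x => U (x, t)) k = c k t := by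
  have hc2 : ∀ k, Integrable (fun t => ‖c k t‖ ^ 2) (timeMeasure T) := fun k => by
    refine hG.mono' ((hm k).norm.pow 2) ?_
    filter_upwards [hcG] with t ht
    simpa using ht {k}
  have hci : ∀ k, Integrable (c k) (timeMeasure T) := fun k =>
    ((memLp_two_iff_integrable_sq_norm (hm k)).2 (hc2 k)).integrable (by norm_num)
  have hh : ∀ k, MemLp (fun p : Torus × ℝ => mFourier k p.1 * c k p.2) 2 (spaceTimeMeasure T) := by
    intro k
    have hmeas : AEStronglyMeasurable (fun p : Torus × ℝ => mFourier k p.1 * c k p.2)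
        (spaceTimeMeasure T) :=
      ((ContinuousMap.continuous (mFourier k)).comp continuous_fst).aestronglyMeasurable.mul
        (hm k).comp_snd
    rw [memLp_two_iff_integrable_sq_norm hmeas]
    simp only [norm_mul, norm_mFourier_apply, one_mul]
    exact (hc2 k).comp_snd torusMeasure
  set H : (Fin 2 → ℤ) → Lp ℂ 2 (spaceTimeMeasure T) := fun k => (hh k).toLp _ with hH
  have hinner : ∀ k m, inner ℂ (H k) (H m)
      = (if m = k then 1 else 0) * ∫ t, conj (c k t) * c m t ∂(timeMeasure T) := by
    intro k m
    have hk : (if m = k then (1 : ℂ) else 0) = ∫ x, mFourier (m - k) x ∂torusMeasure := by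
      rw [integral_mFourier]
      simp only [sub_eq_zero]
    rw [L2.inner_def, hk, ← integral_prod_mul]
    refine integral_congr_ae ?_
    filter_upwards [(hh k).coeFn_toLp, (hh m).coeFn_toLp] with p hp hp'
    rw [hH]
    simp only
    rw [hp, hp', RCLike.inner_apply, map_mul, ← mFourier_neg, sub_eq_add_neg, mFourier_add]
    ring
  have hnorm : ∀ k, ‖H k‖ ^ 2 = ∫ t, ‖c k t‖ ^ 2 ∂(timeMeasure T) := fun k => by
    have h := hinner k k
    rw [if_pos rfl, one_mul, inner_self_eq_norm_sq_to_K] at h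
    have h2 : ∫ t, conj (c k t) * c k t ∂(timeMeasure T)
        = ((∫ t, ‖c k t‖ ^ 2 ∂(timeMeasure T) : ℝ) : ℂ) := by
      rw [← integral_complex_ofReal]
      refine integral_congr_ae (Eventually.of_forall fun t => ?_)
      simp [Complex.conj_mul']
    rw [h2] at h
    rw [← Complex.ofReal_inj, Complex.ofReal_pow]
    exact h
  have hsumsq : Summable fun k => ‖H k‖ ^ 2 := by
    refine summable_of_sum_le (c := ∫ t, G t ∂(timeMeasure T)) (fun k => sq_nonneg _) fun S => ?_
    simp only [hnorm]
    rw [← integral_finsetSum _ fun k _ => hc2 k]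
    refine integral_mono_ae (integrable_finsetSum _ fun k _ => hc2 k) hG ?_
    filter_upwards [hcG] with t ht using ht S
  -- The functions `H k` are orthogonal but not normalized and may vanish, hence the family of their
  -- spans.
  have horth : OrthogonalFamily ℂ (fun k => (Submodule.span ℂ {H k} : Submodule ℂ _))
      (fun k => (Submodule.span ℂ {H k}).subtypeₗᵢ) := by
    refine OrthogonalFamily.of_pairwise fun k m hkm => ?_
    refine Submodule.isOrtho_span.2 ?_
    rintro _ rfl _ rfl
    rw [hinner, if_neg (Ne.symm hkm), zero_mul]
  have hsum : Summable H :=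
    (horth.summable_iff_norm_sq_summable fun k => ⟨H k, Submodule.mem_span_singleton_self _⟩).2
      hsumsq
  obtain ⟨U, hU⟩ := hsum
  refine ⟨U, Lp.memLp U, ae_all_iff.2 fun m => ?_⟩
  have hUi := integrable_of_memLp_two (Lp.memLp U)
  -- Slice coefficients are not continuous functionals on space-time L², but their integrals over
  -- measurable sets of times are: they commute with the sum and select the term k = m.
  refine Integrable.ae_eq_of_forall_setIntegral_eq _ _ (integrable_mFourierCoeff_slice hUi m)
    (hci m) fun A hA _ => ?_
  rw [← integral_cutMode_mul hUi hA m]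
  have hg := memLp_cutMode (T := T) hA m
  have h1 : ∀ f : Torus × ℝ → ℂ, ∀ V : Lp ℂ 2 (spaceTimeMeasure T),
      V =ᵐ[spaceTimeMeasure T] f → inner ℂ (hg.toLp _) V
        = ∫ p, cutMode A (-m) p * f p ∂(spaceTimeMeasure T) := by
    intro f V hV
    rw [L2.inner_def]
    refine integral_congr_ae ?_
    filter_upwards [hg.coeFn_toLp, hV] with p hp hp'
    rw [hp, hp', RCLike.inner_apply, cutMode, cutMode, mFourier_neg, map_mul, mul_comm]
    congr 2
    by_cases hpA : p.2 ∈ A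
    · simp [indicator_of_mem hpA]
    · simp [indicator_of_notMem hpA]
  rw [← h1 U U (ae_eq_refl _)]
  have h2 := (innerSL ℂ (hg.toLp _)).hasSum hU
  refine (h2.unique (a₂ := ∫ t in A, c m t ∂(timeMeasure T)) ?_)
  have h3 : ∀ k, inner ℂ (hg.toLp _) (H k)
      = if k = m then ∫ t in A, c m t ∂(timeMeasure T) else 0 := by
    intro k
    rw [h1 _ (H k) (hh k).coeFn_toLp]
    have : ∀ p : Torus × ℝ, cutMode A (-m) p * (mFourier k p.1 * c k p.2)
        = mFourier (k - m) p.1 * (A.indicator (c k) p.2) := fun p => by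
      rw [cutMode, sub_eq_add_neg, mFourier_add]
      by_cases hpA : p.2 ∈ A
      · simp only [indicator_of_mem hpA]
        ring
      · simp only [indicator_of_notMem hpA]
        ring
    simp only [this]
    rw [integral_prod_mul, integral_mFourier, integral_indicator hA]
    simp only [sub_eq_zero]
    split_ifs with hk
    · rw [hk, one_mul]
    · rw [zero_mul]
  have h4 := hasSum_ite_eq m (∫ t in A, c m t ∂(timeMeasure T))
  rw [← funext h3] at h4
  exact h4

/-- A real space-time function with prescribed Fourier coefficients in space. -/
lemma exists_L2ST_of_coeffs {c : (Fin 2 → ℤ) → ℝ → ℂ} {G : ℝ → ℝ}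
    (hm : ∀ k, AEStronglyMeasurable (c k) (timeMeasure T)) (hG : Integrable G (timeMeasure T))
    (hcG : ∀ᵐ t ∂(timeMeasure T), ∀ S : Finset (Fin 2 → ℤ), ∑ k ∈ S, ‖c k t‖ ^ 2 ≤ G t)
    (hconj : ∀ᵐ t ∂(timeMeasure T), ∀ k, c (-k) t = conj (c k t)) :
    ∃ u : L2ST T, ∀ᵐ t ∂(timeMeasure T), ∀ k, fourierC (fun x => u (x, t)) k = c k t := by
  obtain ⟨U, hU, hUc⟩ := exists_memLp_of_coeffs hm hG hcG
  -- The real part has the coefficients ½(c(k) + conj c(−k)), which equal c(k) by the Hermitian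
  -- symmetry.
  have hre : MemLp (fun p => (U p).re) 2 (spaceTimeMeasure T) := hU.re
  refine ⟨hre.toLp _, ?_⟩
  filter_upwards [ae_slice_of_ae_prod hre.coeFn_toLp, hUc, hconj, memLp_slice hU]
    with t h1 h2 h3 h4 k
  have hi : ∀ m : Fin 2 → ℤ, Integrable (fun x => mFourier m x * U (x, t)) torusMeasure :=
    fun m => (h4.integrable (by norm_num)).bdd_mul (c := 1)
      (ContinuousMap.continuous _).aestronglyMeasurable
      (Eventually.of_forall fun x => (norm_mFourier_apply m x).le)
  have e : ∀ m, c m t = ∫ x, mFourier (-m) x * U (x, t) ∂torusMeasure := fun m => (h2 m).symm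
  rw [fourierC_congr h1, fourierC_eq]
  have h5 : ∀ x, mFourier (-k) x * ((U (x, t)).re : ℂ)
      = 1 / 2 * (mFourier (-k) x * U (x, t)) + 1 / 2 * conj (mFourier k x * U (x, t)) := fun x => by
    rw [Complex.re_eq_add_conj, map_mul, ← mFourier_neg]
    ring
  simp only [h5]
  have hi' : Integrable (fun x => conj (mFourier k x * U (x, t))) torusMeasure :=
    (LinearIsometryEquiv.integrable_comp_iff (Complex.conjLIE)).2 (hi k)
  rw [integral_add ((hi _).const_mul _) (hi'.const_mul _), integral_const_mul, integral_const_mul,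
    integral_conj, ← e k]
  have h6 := e (-k)
  rw [neg_neg] at h6
  rw [← h6, h3 k, Complex.conj_conj]
  ring

end SpaceTime

/-! ### Uniform bounds, weak compactness, and convergence at almost every time. -/

section Compactness

variable {T α : ℝ} {θ₀ : H1dot} {θ : ℝ → H1dot}

lemma IsRegularizedSolution.continuous_fourierC (h : IsRegularizedSolution α θ₀ θ)
    (k : Fin 2 → ℤ) : Continuous fun t => fourierC (h1Val (θ t)) k :=
  continuous_iff_continuousAt.2 fun t => (h.hasDerivAt_fourierC k t).continuousAt

/-- A curve in Ḣ¹ does not come with a jointly measurable function of (x, t). One is assembled from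
the Fourier coefficients, which are continuous in time and square-summable with the energy as a
uniform bound. -/
lemma IsRegularizedSolution.exists_represents (h : IsRegularizedSolution α θ₀ θ) :
    ∃ u : L2ST T, Represents u θ := by
  obtain ⟨u, hu⟩ := exists_L2ST_of_coeffs (T := T) (c := fun k t => fourierC (h1Val (θ t)) k)
    (G := fun _ => energy α θ₀) (fun k => (h.continuous_fourierC k).aestronglyMeasurable)
    (integrable_const _)
    (Eventually.of_forall fun t S =>
      (sum_le_hasSum S (fun _ _ => sq_nonneg _) (hasSum_fourierC_L2_sq (h1Val (θ t)))).trans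
        (h.norm_sq_le t))
    (Eventually.of_forall fun t k => fourierC_neg_index _ k)
  refine ⟨u, ?_⟩
  filter_upwards [hu, memLp_L2ST_slice u] with t h1 h2
  exact ae_eq_of_fourierC_eq h2 (Lp.memLp _) h1

lemma Represents.fourierC_eq {u : L2ST T} (hu : Represents u θ) :
    ∀ᵐ t ∂(timeMeasure T), ∀ k, fourierC (fun x => u (x, t)) k = fourierC (h1Val (θ t)) k := by
  filter_upwards [hu] with t ht k using fourierC_congr ht k

lemma IsRegularizedSolution.norm_represents_sq_le (h : IsRegularizedSolution α θ₀ θ)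
    {u : L2ST T} (hu : Represents u θ) :
    ‖u‖ ^ 2 ≤ ∫ _, energy α θ₀ ∂(timeMeasure T) := by
  rw [L2ST_norm_sq]
  refine integral_mono_ae (integrable_slice_sq u) (integrable_const _) ?_
  filter_upwards [hu] with t ht
  rw [integral_congr_ae (g := fun x => h1Val (θ t) x ^ 2), integral_L2_sq]
  · exact h.norm_sq_le t
  · filter_upwards [ht] with x hx
    rw [hx]

/-- The initial energy increases with α, so its value at α = 1 bounds the whole family. -/
lemma exists_norm_le_of_mem_regularizedSet (T : ℝ) (θ₀ : H1dot) :
    ∃ R : ℝ, ∀ u ∈ regularizedSet T θ₀, ‖u‖ ≤ R := by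
  refine ⟨Real.sqrt (∫ _, energy 1 θ₀ ∂(timeMeasure T)), ?_⟩
  rintro u ⟨α, hα, θ, hθ, hu⟩
  refine Real.le_sqrt_of_sq_le ((hθ.norm_represents_sq_le hu).trans ?_)
  exact integral_mono (integrable_const _) (integrable_const _) fun _ =>
    energy_mono hα.1.le hα.2 θ₀

lemma isCompact_closure_regularizedSet (T : ℝ) (θ₀ : H1dot) :
    IsCompact (closure (toWeakSpace ℝ (L2ST T) '' regularizedSet T θ₀)) := by
  obtain ⟨R, hR⟩ := exists_norm_le_of_mem_regularizedSet T θ₀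
  exact isCompact_closure_toWeakSpace_image (isBounded_iff_forall_norm_le.2 ⟨R, hR⟩)

lemma separableSpace_L2ST (T : ℝ) : TopologicalSpace.SeparableSpace (L2ST T) := by
  have : Fact ((2 : ℝ≥0∞) ≠ ⊤) := ⟨by norm_num⟩
  have : MeasurableSpace.CountablyGenerated (Torus × ℝ) := inferInstance
  have : SFinite (spaceTimeMeasure T) := inferInstance
  have : IsSeparable (spaceTimeMeasure T) := inferInstance
  have : SecondCountableTopology (L2ST T) := Lp.SecondCountableTopology
  infer_instance

lemma exists_subseq_tendsto_regularizedSet {u : ℕ → L2ST T}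
    (hu : ∀ n, u n ∈ regularizedSet T θ₀) :
    ∃ (w : L2ST T) (σ : ℕ → ℕ), StrictMono σ ∧
      Tendsto (fun n => toWeakSpace ℝ (L2ST T) (u (σ n))) atTop
        (𝓝 (toWeakSpace ℝ (L2ST T) w)) := by
  obtain ⟨R, hR⟩ := exists_norm_le_of_mem_regularizedSet T θ₀
  have := separableSpace_L2ST T
  exact exists_subseq_tendsto_toWeakSpace fun n => hR _ (hu n)

/-- Equi-Lipschitz functions whose integrals converge on all measurable sets converge a.e. -/
lemma ae_tendsto_of_tendsto_setIntegral {f : ℕ → ℝ → ℂ} {W : ℝ → ℂ} {K B : ℝ} (hK : 0 ≤ K)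
    (hf : ∀ n s t, ‖f n s - f n t‖ ≤ K * |s - t|) (hB : ∀ n t, ‖f n t‖ ≤ B)
    (hfc : ∀ n, Continuous (f n))
    (hW : Integrable W (timeMeasure T))
    (hfW : ∀ A, MeasurableSet A → Tendsto (fun n => ∫ t in A, f n t ∂(timeMeasure T)) atTop
      (𝓝 (∫ t in A, W t ∂(timeMeasure T)))) :
    ∀ᵐ t ∂(timeMeasure T), Tendsto (fun n => f n t) atTop (𝓝 (W t)) := by
  have hfi : ∀ n, Integrable (f n) (timeMeasure T) := fun n =>
    Integrable.of_bound (hfc n).aestronglyMeasurable B (Eventually.of_forall (hB n))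
  have hcauchy : ∀ t ∈ Ioo (-T) T, CauchySeq fun n => f n t := by
    intro t ht
    rw [Metric.cauchySeq_iff']
    intro ε hε
    obtain ⟨h, hh0, hhT, hhK⟩ : ∃ h : ℝ, 0 < h ∧ t + h < T ∧ K * h ≤ ε / 4 := by
      -- The first entry keeps [t, t+h] inside the time interval, the second makes the Lipschitz
      -- error at most ε/4; `K + 1` avoids division by zero.
      refine ⟨min ((T - t) / 2) (ε / (4 * (K + 1))), ?_, ?_, ?_⟩
      · have := ht.2
        exact lt_min (by linarith) (by positivity)
      · have := min_le_left ((T - t) / 2) (ε / (4 * (K + 1)))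
        linarith [ht.2]
      · calc K * min ((T - t) / 2) (ε / (4 * (K + 1))) ≤ (K + 1) * (ε / (4 * (K + 1))) := by
              refine mul_le_mul (by linarith) (min_le_right _ _) ?_ (by linarith)
              have := ht.2
              exact le_min (by linarith) (by positivity)
          _ = ε / 4 := by field_simp
    set A := Icc t (t + h) with hA
    have hAT : A ⊆ Ioo (-T) T := fun s hs => ⟨ht.1.trans_le hs.1, hs.2.trans_lt hhT⟩
    have hμA : (timeMeasure T).restrict A = volume.restrict A := by
      rw [Measure.restrict_restrict measurableSet_Icc, inter_eq_left.2 hAT]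
    have hvol : (timeMeasure T).real A = h := by
      rw [measureReal_def, ← Measure.restrict_apply_univ, hμA, Measure.restrict_apply_univ,
        Real.volume_Icc, add_sub_cancel_left, ENNReal.toReal_ofReal hh0.le]
    -- The value at t is compared with the mean over [t, t+h]. The means form a Cauchy sequence by
    -- hypothesis, so three errors of size ε/4 are to be added.
    have happrox : ∀ n, ‖∫ s in A, f n s ∂(timeMeasure T) - (h : ℂ) * f n t‖ ≤ ε / 4 * h := by
      intro n
      have h1 : ∫ s in A, (f n s - f n t) ∂(timeMeasure T)
          = ∫ s in A, f n s ∂(timeMeasure T) - (h : ℂ) * f n t := by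
        rw [integral_sub (hfi n).integrableOn (integrable_const _), setIntegral_const, hvol,
          Complex.real_smul]
      rw [← h1]
      have h2 := norm_setIntegral_le_of_norm_le_const (μ := timeMeasure T) (s := A)
        (f := fun s => f n s - f n t) (C := ε / 4) (measure_lt_top _ _) (fun s hs => by
          refine (hf n s t).trans (le_trans ?_ hhK)
          refine mul_le_mul_of_nonneg_left ?_ hK
          rw [abs_of_nonneg (by linarith [hs.1])]
          linarith [hs.2])
      rwa [hvol] at h2
    obtain ⟨N, hN⟩ := Metric.cauchySeq_iff'.1 (hfW A measurableSet_Icc).cauchySeq (ε / 4 * h)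
      (by positivity)
    refine ⟨N, fun n hn => ?_⟩
    have h3 := hN n hn
    rw [dist_eq_norm] at h3 ⊢
    have h4 : (h : ℂ) * (f n t - f N t)
        = (∫ s in A, f n s ∂(timeMeasure T) - ∫ s in A, f N s ∂(timeMeasure T))
          - (∫ s in A, f n s ∂(timeMeasure T) - (h : ℂ) * f n t)
          + (∫ s in A, f N s ∂(timeMeasure T) - (h : ℂ) * f N t) := by ring
    have h5 : h * ‖f n t - f N t‖ < ε * h := by
      calc h * ‖f n t - f N t‖ = ‖(h : ℂ) * (f n t - f N t)‖ := by
            rw [norm_mul, Complex.norm_real, Real.norm_of_nonneg hh0.le]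
        _ ≤ _ := by
            rw [h4]
            exact (norm_add_le _ _).trans (add_le_add_left (norm_sub_le _ _) _)
        _ < ε / 4 * h + ε / 4 * h + ε / 4 * h :=
            add_lt_add_of_lt_of_le (add_lt_add_of_lt_of_le h3 (happrox n)) (happrox N)
        _ ≤ ε * h := by nlinarith
    rw [mul_comm ε h] at h5
    exact lt_of_mul_lt_mul_left h5 hh0.le
  have hex : ∀ t, ∃ g, t ∈ Ioo (-T) T → Tendsto (fun n => f n t) atTop (𝓝 g) := fun t => by
    by_cases ht : t ∈ Ioo (-T) T
    · obtain ⟨g, hg⟩ := cauchySeq_tendsto_of_complete (hcauchy t ht)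
      exact ⟨g, fun _ => hg⟩
    · exact ⟨0, fun h => absurd h ht⟩
  choose g hg using hex
  have hgt : ∀ᵐ t ∂(timeMeasure T), Tendsto (fun n => f n t) atTop (𝓝 (g t)) := by
    filter_upwards [ae_restrict_mem measurableSet_Ioo] with t ht using hg t ht
  have hgm : AEStronglyMeasurable g (timeMeasure T) :=
    aestronglyMeasurable_of_tendsto_ae atTop (fun n => (hfc n).aestronglyMeasurable) hgt
  have hgB : ∀ᵐ t ∂(timeMeasure T), ‖g t‖ ≤ B := by
    filter_upwards [hgt] with t ht
    exact le_of_tendsto ht.norm (Eventually.of_forall fun n => hB n t)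
  -- The pointwise limit is identified with `W`: by dominated convergence both have the same
  -- integral over every measurable set.
  have hgW : g =ᵐ[timeMeasure T] W := by
    refine Integrable.ae_eq_of_forall_setIntegral_eq _ _ (Integrable.of_bound hgm B hgB) hW
      fun A hA _ => ?_
    refine tendsto_nhds_unique ?_ (hfW A hA)
    exact tendsto_integral_of_dominated_convergence (fun _ => B)
      (fun n => (hfc n).aestronglyMeasurable) (integrable_const _)
      (fun n => Eventually.of_forall (hB n)) (ae_restrict_of_ae hgt)
  filter_upwards [hgt, hgW] with t h1 h2
  rwa [h2] at h1

end Compactness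

/-! ### Passage to the limit in a single Fourier mode. -/

section ModeLimit

variable {T : ℝ}

/-- Passage to the limit in the weak form of a sequence of scalar equations `(Λₙ aₙ)' = Nₙ`. -/
lemma tendsto_weak_form {a a' N : ℕ → ℝ → ℂ} {Λ : ℕ → ℝ} {W NW : ℝ → ℂ} {B C D s : ℝ} {L : ℂ}
    (hs : s ∈ Ico (-T) T)
    (hd : ∀ n t, HasDerivAt (a n) (a' n t) t) (hN : ∀ n t, (Λ n : ℂ) * a' n t = N n t)
    (hNc : ∀ n, Continuous (N n)) (hΛ : Tendsto Λ atTop (𝓝 1))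
    (hB : ∀ n t, ‖a n t‖ ≤ B) (hC : ∀ n t, ‖N n t‖ ≤ C)
    (haW : ∀ᵐ t ∂(timeMeasure T), Tendsto (fun n => a n t) atTop (𝓝 (W t)))
    (hNW : ∀ᵐ t ∂(timeMeasure T), Tendsto (fun n => N n t) atTop (𝓝 (NW t)))
    {η η' : ℝ → ℂ} (hη : ∀ t, HasDerivAt η (η' t) t) (hη'c : Continuous η')
    (hηD : ∀ t, ‖η t‖ ≤ D) (hηD' : ∀ t, ‖η' t‖ ≤ D) (hηT : η T = 0)
    (hL : Tendsto (fun n => a n s * η s) atTop (𝓝 L)) :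
    ∫ t in Ioo s T, (W t * η' t + NW t * η t) = - L := by
  have hΛc : Tendsto (fun n => (Λ n : ℂ)) atTop (𝓝 1) := by
    have := (Complex.continuous_ofReal.tendsto 1).comp hΛ
    rw [Complex.ofReal_one] at this
    exact this
  have hηc : Continuous η := continuous_iff_continuousAt.2 fun t => (hη t).continuousAt
  have hac : ∀ n, Continuous (a n) := fun n =>
    continuous_iff_continuousAt.2 fun t => (hd n t).continuousAt
  have hB0 : 0 ≤ B := (norm_nonneg _).trans (hB 0 0)
  have hC0 : 0 ≤ C := (norm_nonneg _).trans (hC 0 0)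
  have hD0 : 0 ≤ D := (norm_nonneg _).trans (hηD 0)
  have hcont : ∀ n, Continuous fun t => (Λ n : ℂ) * (a n t * η' t) + N n t * η t := fun n =>
    (continuous_const.mul ((hac n).mul hη'c)).add ((hNc n).mul hηc)
  -- The integrand is the derivative of Λ a η because Λ a' = N. Since η(T) = 0, only the boundary
  -- term at s survives.
  have hftc : ∀ n, ∫ t in Ioo s T, ((Λ n : ℂ) * (a n t * η' t) + N n t * η t)
      = - ((Λ n : ℂ) * (a n s * η s)) := by
    intro n
    rw [← integral_Ioc_eq_integral_Ioo, ← intervalIntegral.integral_of_le hs.2.le,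
      intervalIntegral.integral_eq_sub_of_hasDerivAt (f := fun t => (Λ n : ℂ) * (a n t * η t))
        (fun t _ => ?_) ((hcont n).intervalIntegrable _ _)]
    · rw [hηT]
      ring
    · refine (((hd n t).mul (hη t)).const_mul (Λ n : ℂ)).congr_deriv ?_
      rw [← hN]
      ring
  obtain ⟨E, hE⟩ := hΛ.norm.bddAbove_range
  have hE' : ∀ n, ‖(Λ n : ℂ)‖ ≤ E := fun n => by
    rw [Complex.norm_real]
    exact hE ⟨n, rfl⟩
  have hsub : Ioo s T ⊆ Ioo (-T) T := Ioo_subset_Ioo_left hs.1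
  have hlim : Tendsto (fun n => ∫ t in Ioo s T, ((Λ n : ℂ) * (a n t * η' t) + N n t * η t)) atTop
      (𝓝 (∫ t in Ioo s T, (W t * η' t + NW t * η t))) := by
    refine tendsto_integral_of_dominated_convergence (fun _ => E * (B * D) + C * D)
      (fun n => (hcont n).aestronglyMeasurable) (integrable_const _)
      (fun n => Eventually.of_forall fun t => ?_) ?_
    · refine (norm_add_le _ _).trans (add_le_add ?_ ?_)
      · rw [norm_mul, norm_mul]
        exact mul_le_mul (hE' n) (mul_le_mul (hB n t) (hηD' t) (norm_nonneg _) hB0)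
          (by positivity) ((norm_nonneg _).trans (hE' n))
      · rw [norm_mul]
        exact mul_le_mul (hC n t) (hηD t) (norm_nonneg _) hC0
    · filter_upwards [ae_restrict_of_ae_restrict_of_subset hsub haW,
        ae_restrict_of_ae_restrict_of_subset hsub hNW] with t h1 h2
      have := (hΛc.mul (h1.mul_const (η' t))).add (h2.mul_const (η t))
      rwa [one_mul] at this
  refine tendsto_nhds_unique hlim ?_
  simp only [hftc]
  have := (hΛc.mul hL).neg
  rwa [one_mul] at this

variable {α : ℕ → ℝ} {θ₀ : H1dot} {θ : ℕ → ℝ → H1dot} {u : ℕ → L2ST T} {w : L2ST T}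

/-- The sequence α is not assumed to stay below 1; being convergent, it is bounded, and the energy
is monotone in α. -/
lemma exists_energy_le (hα : ∀ n, 0 < α n) (hα0 : Tendsto α atTop (𝓝 0)) (θ₀ : H1dot) :
    ∃ M, ∀ n, energy (α n) θ₀ ≤ M := by
  obtain ⟨A, hA⟩ := hα0.bddAbove_range
  exact ⟨energy A θ₀, fun n => energy_mono (hα n).le (hA ⟨n, rfl⟩) θ₀⟩

section Single

variable {β M : ℝ} {ϑ : ℝ → H1dot}

lemma IsRegularizedSolution.tsum_le (h : IsRegularizedSolution β θ₀ ϑ)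
    (hM : energy β θ₀ ≤ M) (t : ℝ) : ∑' k, ‖fourierC (h1Val (ϑ t)) k‖ ^ 2 ≤ M := by
  rw [(hasSum_fourierC_L2_sq _).tsum_eq]
  exact (h.norm_sq_le t).trans hM

lemma IsRegularizedSolution.norm_fourierC_le (h : IsRegularizedSolution β θ₀ ϑ)
    (hM : energy β θ₀ ≤ M) (t : ℝ) (k : Fin 2 → ℤ) :
    ‖fourierC (h1Val (ϑ t)) k‖ ≤ Real.sqrt M :=
  (norm_fourierC_L2_le _ k).trans (Real.le_sqrt_of_sq_le ((h.norm_sq_le t).trans hM))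

lemma IsRegularizedSolution.norm_nonlin_le (h : IsRegularizedSolution β θ₀ ϑ)
    (hM : energy β θ₀ ≤ M) (t : ℝ) (l : Fin 2 → ℤ) :
    ‖nonlin (fourierC (h1Val (ϑ t))) l‖ ≤ 2 * Real.pi * freqNorm l * M :=
  (SQG.norm_nonlin_le (hasSum_fourierC_L2_sq _).summable l).trans
    (mul_le_mul_of_nonneg_left (h.tsum_le hM t)
      (mul_nonneg (by positivity) (freqNorm_nonneg l)))

/-- The factor 1 + α²(2π|l|)² is at least 1 and may be dropped, so the Lipschitz constant of a mode
does not depend on α. -/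
lemma IsRegularizedSolution.norm_fourierC_deriv_le (h : IsRegularizedSolution β θ₀ ϑ)
    (hM : energy β θ₀ ≤ M) (t : ℝ) (l : Fin 2 → ℤ) :
    ‖fourierC (h1Val (deriv ϑ t)) l‖ ≤ 2 * Real.pi * freqNorm l * M := by
  refine le_trans ?_ (h.norm_nonlin_le hM t l)
  rw [← h.mode_eq t l, norm_mul, Complex.norm_real, Real.norm_of_nonneg (by positivity)]
  exact le_mul_of_one_le_left (norm_nonneg _) (le_add_of_nonneg_right (by positivity))

lemma IsRegularizedSolution.norm_fourierC_sub_le (h : IsRegularizedSolution β θ₀ ϑ)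
    (hM : energy β θ₀ ≤ M) (l : Fin 2 → ℤ) (s t : ℝ) :
    ‖fourierC (h1Val (ϑ s)) l - fourierC (h1Val (ϑ t)) l‖
      ≤ 2 * Real.pi * freqNorm l * M * |s - t| :=
  convex_univ.norm_image_sub_le_of_norm_hasDerivWithin_le
    (f := fun s => fourierC (h1Val (ϑ s)) l)
    (fun r _ => (h.hasDerivAt_fourierC l r).hasDerivWithinAt)
    (fun r _ => h.norm_fourierC_deriv_le hM r l) (mem_univ t) (mem_univ s)

/-- By the mode equation the infinite series is a constant times the coefficient of ∂ₜθ, which is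
continuous for a C¹ curve. -/
lemma IsRegularizedSolution.continuous_nonlin (h : IsRegularizedSolution β θ₀ ϑ)
    (l : Fin 2 → ℤ) : Continuous fun t => nonlin (fourierC (h1Val (ϑ t))) l := by
  simp only [← h.mode_eq]
  exact continuous_const.mul (((fourierCLM l).comp h1ValCLM).continuous.comp
    (h.contDiff.continuous_deriv (le_refl _)))

end Single

/-- Weak convergence in space-time gives convergence of the integrals of a mode over sets of times;
the uniform Lipschitz bound upgrades this to convergence at almost every time. -/
lemma ae_tendsto_fourierC {M : ℝ} (hM : ∀ n, energy (α n) θ₀ ≤ M)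
    (hθ : ∀ n, IsRegularizedSolution (α n) θ₀ (θ n)) (hu : ∀ n, Represents (u n) (θ n))
    (huw : Tendsto (fun n => toWeakSpace ℝ (L2ST T) (u n)) atTop (𝓝 (toWeakSpace ℝ (L2ST T) w))) :
    ∀ᵐ t ∂(timeMeasure T), ∀ k, Tendsto (fun n => fourierC (h1Val (θ n t)) k) atTop
      (𝓝 (fourierC (fun x => w (x, t)) k)) := by
  have hM0 : 0 ≤ M := (by unfold energy; positivity : 0 ≤ energy (α 0) θ₀).trans (hM 0)
  rw [ae_all_iff]
  intro k
  refine ae_tendsto_of_tendsto_setIntegral (K := 2 * Real.pi * freqNorm k * M)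
    (B := Real.sqrt M) (mul_nonneg (mul_nonneg (by positivity) (freqNorm_nonneg k)) hM0)
    (fun n s t => (hθ n).norm_fourierC_sub_le (hM n) k s t)
    (fun n t => (hθ n).norm_fourierC_le (hM n) t k) (fun n => (hθ n).continuous_fourierC k)
    (integrable_fourierC_slice w k) fun A hA => ?_
  have he : ∀ n, ∫ t in A, fourierC (h1Val (θ n t)) k ∂(timeMeasure T)
      = ∫ t in A, fourierC (fun x => u n (x, t)) k ∂(timeMeasure T) := fun n => by
    refine integral_congr_ae (ae_restrict_of_ae ?_)
    filter_upwards [(hu n).fourierC_eq] with t ht using (ht k).symm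
  simp only [he]
  have key : ∀ z : ℂ, Tendsto
      (fun n => (z * ∫ t in A, fourierC (fun x => u n (x, t)) k ∂(timeMeasure T)).re) atTop
      (𝓝 (z * ∫ t in A, fourierC (fun x => w (x, t)) k ∂(timeMeasure T)).re) := fun z => by
    obtain ⟨g, hg⟩ := exists_inner_eq_setIntegral_fourierC (T := T) hA k z
    simp only [← hg]
    exact tendsto_toWeakSpace_iff.1 huw g
  have k1 := key 1
  have k2 := key (-Complex.I)
  simp only [one_mul] at k1
  have him : ∀ z : ℂ, (-Complex.I * z).re = z.im := fun z => by simp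
  simp only [him] at k2
  have := ((Complex.continuous_ofReal.tendsto _).comp k1).add
    (((Complex.continuous_ofReal.tendsto _).comp k2).mul_const Complex.I)
  simpa only [Function.comp_def, Complex.re_add_im] using this

lemma summable_fourierC_slice (w : L2ST T) :
    ∀ᵐ t ∂(timeMeasure T), Summable fun k => ‖fourierC (fun x => w (x, t)) k‖ ^ 2 := by
  filter_upwards [memLp_L2ST_slice w] with t ht using (hasSum_fourierC_sq ht).summable

/-- The weak form of the limit equation for a single Fourier mode. -/
lemma weak_form_mode (hα : Tendsto α atTop (𝓝 0)) {M : ℝ} (hM : ∀ n, energy (α n) θ₀ ≤ M)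
    (hθ : ∀ n, IsRegularizedSolution (α n) θ₀ (θ n))
    (haw : ∀ᵐ t ∂(timeMeasure T), ∀ k, Tendsto (fun n => fourierC (h1Val (θ n t)) k) atTop
      (𝓝 (fourierC (fun x => w (x, t)) k)))
    {η η' : ℝ → ℂ} {D : ℝ} (hη : ∀ t, HasDerivAt η (η' t) t) (hη'c : Continuous η')
    (hηD : ∀ t, ‖η t‖ ≤ D) (hηD' : ∀ t, ‖η' t‖ ≤ D) (hηT : η T = 0) (k : Fin 2 → ℤ)
    {s : ℝ} (hs : s ∈ Ico (-T) T) {L : ℂ}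
    (hL : ∀ n, fourierC (h1Val (θ n s)) k * η s = L) :
    ∫ t in Ioo s T, (fourierC (fun x => w (x, t)) k * η' t
      + nonlin (fourierC (fun x => w (x, t))) k * η t) = - L := by
  refine tendsto_weak_form hs (a := fun n t => fourierC (h1Val (θ n t)) k)
    (a' := fun n t => fourierC (h1Val (deriv (θ n) t)) k)
    (N := fun n t => nonlin (fourierC (h1Val (θ n t))) k)
    (Λ := fun n => 1 + α n ^ 2 * (2 * Real.pi * freqNorm k) ^ 2)
    (fun n t => (hθ n).hasDerivAt_fourierC k t) (fun n t => (hθ n).mode_eq t k)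
    (fun n => (hθ n).continuous_nonlin k) ?_ (fun n t => (hθ n).norm_fourierC_le (hM n) t k)
    (fun n t => (hθ n).norm_nonlin_le (hM n) t k) ?_ ?_ hη hη'c hηD hηD' hηT ?_
  · have := ((hα.pow 2).mul_const ((2 * Real.pi * freqNorm k) ^ 2)).const_add 1
    simpa using this
  · filter_upwards [haw] with t ht using ht k
  · filter_upwards [haw, summable_fourierC_slice w] with t ht hs
    exact tendsto_nonlin (fun n => (hasSum_fourierC_L2_sq _).summable)
      (fun n => (hθ n).tsum_le (hM n) t) hs ht k
  · simp only [hL]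
    exact tendsto_const_nhds

/-- Uniform bounds for the modes of the limit. -/
lemma ae_bounds_limit {M : ℝ} (hM : ∀ n, energy (α n) θ₀ ≤ M)
    (hθ : ∀ n, IsRegularizedSolution (α n) θ₀ (θ n))
    (haw : ∀ᵐ t ∂(timeMeasure T), ∀ k, Tendsto (fun n => fourierC (h1Val (θ n t)) k) atTop
      (𝓝 (fourierC (fun x => w (x, t)) k))) :
    ∀ᵐ t ∂(timeMeasure T), ∀ k, ‖fourierC (fun x => w (x, t)) k‖ ≤ Real.sqrt M ∧
      ‖nonlin (fourierC (fun x => w (x, t))) k‖ ≤ 2 * Real.pi * freqNorm k * M := by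
  filter_upwards [haw, summable_fourierC_slice w] with t ht hs k
  refine ⟨le_of_tendsto (ht k).norm (Eventually.of_forall fun n =>
    (hθ n).norm_fourierC_le (hM n) t k), ?_⟩
  exact le_of_tendsto (tendsto_nonlin (fun n => (hasSum_fourierC_L2_sq _).summable)
      (fun n => (hθ n).tsum_le (hM n) t) hs ht k).norm
    (Eventually.of_forall fun n => (hθ n).norm_nonlin_le (hM n) t k)

lemma aestronglyMeasurable_nonlin_limit (hθ : ∀ n, IsRegularizedSolution (α n) θ₀ (θ n))
    {M : ℝ} (hM : ∀ n, energy (α n) θ₀ ≤ M)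
    (haw : ∀ᵐ t ∂(timeMeasure T), ∀ k, Tendsto (fun n => fourierC (h1Val (θ n t)) k) atTop
      (𝓝 (fourierC (fun x => w (x, t)) k))) (k : Fin 2 → ℤ) :
    AEStronglyMeasurable (fun t => nonlin (fourierC (fun x => w (x, t))) k) (timeMeasure T) := by
  refine aestronglyMeasurable_of_tendsto_ae atTop
    (fun n => ((hθ n).continuous_nonlin k).aestronglyMeasurable) ?_
  filter_upwards [haw, summable_fourierC_slice w] with t ht hs
  exact tendsto_nonlin (fun n => (hasSum_fourierC_L2_sq _).summable)
      (fun n => (hθ n).tsum_le (hM n) t) hs ht k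

lemma ae_mean_zero_limit
    (haw : ∀ᵐ t ∂(timeMeasure T), ∀ k, Tendsto (fun n => fourierC (h1Val (θ n t)) k) atTop
      (𝓝 (fourierC (fun x => w (x, t)) k))) :
    ∀ᵐ t ∂(timeMeasure T), fourierC (fun x => w (x, t)) 0 = 0 := by
  filter_upwards [haw] with t ht
  have := ht 0
  simp only [fourierC_h1Val_zero] at this
  exact tendsto_nhds_unique this tendsto_const_nhds

end ModeLimit

/-! ### Stream function and velocity by Fourier multipliers. -/

section Velocity

variable {T : ℝ}

/-- Stream function and velocity of a space-time function, slice by slice. -/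
lemma exists_stream_velocity {w : L2ST T}
    (hw : ∀ᵐ t ∂(timeMeasure T), fourierC (fun x => w (x, t)) 0 = 0) :
    ∃ (ψ : L2ST T) (v : Fin 2 → L2ST T), ∀ᵐ t ∂(timeMeasure T),
      IsStreamFunction (fun x => w (x, t)) (fun x => ψ (x, t)) ∧
      IsPerpGrad (fun x => ψ (x, t)) (fun i x => v i (x, t)) ∧
      (∫ x, w (x, t) ∂torusMeasure = 0) ∧ ∀ i, ∫ x, v i (x, t) ∂torusMeasure = 0 := by
  -- The stream function and both velocity components arise from `w` by multipliers of modulus at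
  -- most 1 with Hermitian symmetry; the symmetry keeps the functions real.
  have hexists : ∀ m : (Fin 2 → ℤ) → ℂ, (∀ k, ‖m k‖ ≤ 1) → (∀ k, m (-k) = conj (m k)) →
      ∃ u : L2ST T, ∀ᵐ t ∂(timeMeasure T), ∀ k,
        fourierC (fun x => u (x, t)) k = m k * fourierC (fun x => w (x, t)) k := by
    intro m hm hmc
    refine exists_L2ST_of_coeffs (c := fun k t => m k * fourierC (fun x => w (x, t)) k)
      (G := fun t => ∫ x, w (x, t) ^ 2 ∂torusMeasure)
      (fun k => (integrable_fourierC_slice w k).1.const_mul _) (integrable_slice_sq w) ?_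
      (Eventually.of_forall fun t k => ?_)
    · filter_upwards [memLp_L2ST_slice w] with t ht S
      refine le_trans (Finset.sum_le_sum fun k _ => ?_)
        (sum_le_hasSum S (fun _ _ => sq_nonneg _) (hasSum_fourierC_sq ht))
      refine pow_le_pow_left₀ (norm_nonneg _) ?_ 2
      rw [norm_mul]
      exact mul_le_of_le_one_left (norm_nonneg _) (hm k)
    · rw [hmc, fourierC_neg_index, map_mul]
  -- The convention `0⁻¹ = 0` makes the multiplier vanish at `k = 0`; elsewhere 2π|k| ≥ 1.
  set mψ : (Fin 2 → ℤ) → ℂ := fun k => ((2 * Real.pi * freqNorm k : ℝ) : ℂ)⁻¹ with hmψ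
  have hmψc : ∀ k, mψ (-k) = conj (mψ k) := fun k => by
    simp only [hmψ, freqNorm_neg, map_inv₀, Complex.conj_ofReal]
  have hmψ0 : mψ 0 = 0 := by simp [hmψ, freqNorm_zero]
  have hpi : (1 : ℝ) ≤ 2 * Real.pi := by linarith [Real.pi_gt_three]
  have hmψn : ∀ k, ‖mψ k‖ ≤ 1 := fun k => by
    rcases eq_or_ne k 0 with rfl | hk
    · simp [hmψ0]
    · rw [hmψ, norm_inv, Complex.norm_real, Real.norm_of_nonneg (by
        have := freqNorm_nonneg k
        positivity)]
      refine inv_le_one_of_one_le₀ ?_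
      exact one_le_mul_of_one_le_of_one_le hpi (one_le_freqNorm hk)
  have hmv : ∀ i k, ‖2 * Real.pi * Complex.I * (k i : ℂ) * mψ k‖ ≤ 1 := fun i k => by
    rcases eq_or_ne k 0 with rfl | hk
    · simp [hmψ0]
    · have hk' := freqNorm_pos hk
      rw [hmψ, norm_mul, norm_inv, Complex.norm_real, Real.norm_of_nonneg (by positivity)]
      simp only [norm_mul, Complex.norm_real, Complex.norm_I, Complex.norm_intCast,
        Complex.norm_ofNat, Real.norm_of_nonneg Real.pi_pos.le, mul_one]
      rw [← div_eq_mul_inv, div_le_one (by positivity)]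
      exact mul_le_mul_of_nonneg_left (abs_apply_le_freqNorm k i) (by positivity)
  have hmvc : ∀ i (k : Fin 2 → ℤ), 2 * Real.pi * Complex.I * ((-k) i : ℤ) * mψ (-k)
      = conj (2 * Real.pi * Complex.I * (k i : ℂ) * mψ k) := fun i k => by
    rw [hmψc]
    simp only [map_mul, Complex.conj_I, Complex.conj_ofReal, map_ofNat, map_intCast, Pi.neg_apply,
      Int.cast_neg]
    ring
  obtain ⟨ψ, hψ⟩ := hexists mψ hmψn hmψc
  obtain ⟨v0, hv0⟩ := hexists (fun k => -(2 * Real.pi * Complex.I * (k 1 : ℂ) * mψ k))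
    (fun k => by rw [norm_neg]; exact hmv 1 k) (fun k => by rw [hmvc, map_neg])
  obtain ⟨v1, hv1⟩ := hexists (fun k => 2 * Real.pi * Complex.I * (k 0 : ℂ) * mψ k)
    (hmv 0) (hmvc 0)
  refine ⟨ψ, ![v0, v1], ?_⟩
  filter_upwards [hψ, hv0, hv1, hw] with t h1 h2 h3 h4
  refine ⟨⟨fun k => ?_, ?_⟩, ⟨fun k => ?_, fun k => ?_⟩, ?_, fun i => ?_⟩
  · rw [h1, ← freqNorm]
    rcases eq_or_ne k 0 with rfl | hk
    · rw [h4, mul_zero, mul_zero]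
    · have : ((2 * Real.pi * freqNorm k : ℝ) : ℂ) ≠ 0 := by
        have := freqNorm_pos hk
        exact_mod_cast (by positivity : (2 * Real.pi * freqNorm k : ℝ) ≠ 0)
      rw [hmψ]
      simp only
      rw [mul_inv_cancel_left₀ this]
  · rw [← fourierC_zero_index_eq_zero_iff, h1, h4, mul_zero]
  · rw [fourierC_neg, h1]
    refine (congrArg Neg.neg (h2 k)).trans ?_
    ring
  · rw [h1]
    refine (h3 k).trans ?_
    ring
  · rw [← fourierC_zero_index_eq_zero_iff, h4]
  · rw [← fourierC_zero_index_eq_zero_iff]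
    fin_cases i
    · exact (h2 0).trans (by rw [h4, mul_zero])
    · exact (h3 0).trans (by rw [h4, mul_zero])

end Velocity

/-! ### Test functions: derivatives through the covering map, decay of coefficients. -/

section TestFunctions

variable {T : ℝ} {φ : Torus × ℝ → ℝ}

/-- The covering map `ℝ² × ℝ → Ω × ℝ`. -/
def covering (p : (Fin 2 → ℝ) × ℝ) : Torus × ℝ := ((fun i => (p.1 i : UnitAddCircle)), p.2)

lemma isOpenQuotientMap_covering : IsOpenQuotientMap covering := by
  have h : IsOpenQuotientMap (fun y : Fin 2 → ℝ => (fun i => (y i : UnitAddCircle) : Torus)) :=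
    IsOpenQuotientMap.piMap fun _ => QuotientAddGroup.isOpenQuotientMap_mk
  exact h.prodMap IsOpenQuotientMap.id

lemma covering_add_single (y : Fin 2 → ℝ) (t : ℝ) (i : Fin 2) (s : ℝ) :
    ((covering (y, t)).1 + Pi.single i (s : UnitAddCircle), t)
      = covering ((y, t) + s • ((Pi.single i (1 : ℝ), 0) : (Fin 2 → ℝ) × ℝ)) := by
  refine Prod.ext ?_ (by simp [covering])
  funext j
  rcases eq_or_ne j i with rfl | hj
  · simp [covering]
  · simp [covering, Pi.single_eq_of_ne hj]

lemma covering_add_time (y : Fin 2 → ℝ) (t : ℝ) (s : ℝ) :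
    ((covering (y, t)).1, t + s)
      = covering ((y, t) + s • ((0, 1) : (Fin 2 → ℝ) × ℝ)) := by
  simp [covering]

lemma IsTestFunction.contDiff_covering (hφ : IsTestFunction T φ) :
    ContDiff ℝ ∞ (fun p => φ (covering p)) := hφ.smooth

lemma IsTestFunction.continuous (hφ : IsTestFunction T φ) : Continuous φ :=
  isOpenQuotientMap_covering.isQuotientMap.continuous_iff.2 hφ.contDiff_covering.continuous

lemma IsTestFunction.exists_bound (hφ : IsTestFunction T φ) : ∃ C, ∀ p, ‖φ p‖ ≤ C :=
  hφ.hasCompactSupport.exists_bound_of_continuous hφ.continuous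

lemma hasDerivAt_along_line {E : Type*} [NormedAddCommGroup E] [NormedSpace ℝ E] {f : E → ℝ}
    (hf : ContDiff ℝ ∞ f) (p h : E) :
    HasDerivAt (fun s : ℝ => f (p + s • h)) (fderiv ℝ f p h) 0 := by
  have h1 : HasDerivAt (fun s : ℝ => p + s • h) h 0 := by
    have := ((hasDerivAt_id (0 : ℝ)).smul_const h).const_add p
    simpa using this
  have h2 : HasFDerivAt f (fderiv ℝ f (p + (0 : ℝ) • h)) (p + (0 : ℝ) • h) :=
    (hf.differentiable (by simp) _).hasFDerivAt
  have h3 := h2.comp_hasDerivAt (0 : ℝ) h1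
  rw [zero_smul, add_zero] at h3
  exact h3

lemma IsTestFunction.hasDerivAt_dx_zero (hφ : IsTestFunction T φ) (i : Fin 2)
    (q : (Fin 2 → ℝ) × ℝ) :
    HasDerivAt (fun s : ℝ => φ ((covering q).1 + Pi.single i (s : UnitAddCircle), q.2))
      (fderiv ℝ (fun p => φ (covering p)) q (Pi.single i (1 : ℝ), 0)) 0 := by
  have h := hasDerivAt_along_line hφ.contDiff_covering q (Pi.single i (1 : ℝ), 0)
  simpa only [covering_add_single q.1 q.2] using h

lemma IsTestFunction.hasDerivAt_dt_zero (hφ : IsTestFunction T φ) (q : (Fin 2 → ℝ) × ℝ) :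
    HasDerivAt (fun s : ℝ => φ ((covering q).1, q.2 + s))
      (fderiv ℝ (fun p => φ (covering p)) q (0, 1)) 0 := by
  have h := hasDerivAt_along_line hφ.contDiff_covering q (0, 1)
  simpa only [covering_add_time q.1 q.2] using h

lemma IsTestFunction.dx_covering (hφ : IsTestFunction T φ) (i : Fin 2)
    (q : (Fin 2 → ℝ) × ℝ) :
    dx i φ (covering q) = fderiv ℝ (fun p => φ (covering p)) q (Pi.single i (1 : ℝ), 0) :=
  (hφ.hasDerivAt_dx_zero i q).deriv

lemma IsTestFunction.hasDerivAt_dt (hφ : IsTestFunction T φ) (x : Torus) (t : ℝ) :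
    HasDerivAt (fun s => φ (x, s)) (dt φ (x, t)) t := by
  obtain ⟨⟨y, t'⟩, hy⟩ := isOpenQuotientMap_covering.surjective (x, t)
  obtain ⟨rfl, rfl⟩ := Prod.ext_iff.1 hy
  have h := hφ.hasDerivAt_dt_zero (y, t')
  have h1 : HasDerivAt (fun s : ℝ => φ ((covering (y, t')).1, s))
      (fderiv ℝ (fun p => φ (covering p)) (y, t') (0, 1)) t' := by
    have h2 : HasDerivAt (fun s : ℝ => s - t') 1 t' := (hasDerivAt_id t').sub_const t'
    have h3 := HasDerivAt.scomp_of_eq t' h h2 (sub_self t').symm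
    simpa [Function.comp_def] using h3
  exact h1.differentiableAt.hasDerivAt

lemma IsTestFunction.dt_covering (hφ : IsTestFunction T φ) (q : (Fin 2 → ℝ) × ℝ) :
    dt φ (covering q) = fderiv ℝ (fun p => φ (covering p)) q (0, 1) := by
  have h1 := hφ.hasDerivAt_dt (covering q).1 q.2
  have h2 : HasDerivAt (fun s : ℝ => φ ((covering q).1, q.2 + s)) (dt φ (covering q)) 0 :=
    HasDerivAt.comp_const_add q.2 0 (by rw [add_zero]; exact h1)
  exact h2.unique (hφ.hasDerivAt_dt_zero q)

lemma IsTestFunction.hasDerivAt_dx (hφ : IsTestFunction T φ) (i : Fin 2) (x : Torus) (t s : ℝ) :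
    HasDerivAt (fun r : ℝ => φ (x + Pi.single i (r : UnitAddCircle), t))
      (dx i φ (x + Pi.single i (s : UnitAddCircle), t)) s := by
  obtain ⟨⟨y, t'⟩, hy⟩ := isOpenQuotientMap_covering.surjective
    (x + Pi.single i (s : UnitAddCircle), t)
  obtain ⟨hx, rfl⟩ := Prod.ext_iff.1 hy
  simp only at hx
  have h := hφ.hasDerivAt_dx_zero i (y, t')
  rw [← hφ.dx_covering, hx] at h
  have h2 : HasDerivAt (fun r : ℝ => r - s) 1 s := (hasDerivAt_id s).sub_const s
  have h3 := HasDerivAt.scomp_of_eq s h h2 (sub_self s).symm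
  rw [one_smul] at h3
  have he : covering (y, t') = (x + Pi.single i (s : UnitAddCircle), t') := Prod.ext hx rfl
  rw [he] at h3
  convert! h3 using 2 with r
  simp only [Function.comp_apply]
  rw [add_assoc, ← Pi.single_add, ← AddCircle.coe_add, add_sub_cancel]
  rfl

/-- Derivatives of the lift in a fixed direction inherit smoothness and support. The class of test
functions is thus closed under `dx` and `dt`, which permits the repeated differentiation in
`IsTestFunction.exists_decay`. -/
lemma IsTestFunction.of_deriv {χ : Torus × ℝ → ℝ} (hφ : IsTestFunction T φ)
    (h : (Fin 2 → ℝ) × ℝ)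
    (hχ : ∀ q, χ (covering q) = fderiv ℝ (fun p => φ (covering p)) q h) :
    IsTestFunction T χ := by
  have hsupp : tsupport χ ⊆ tsupport φ := by
    refine closure_minimal (fun p hp => ?_) (isClosed_tsupport φ)
    by_contra hcon
    apply hp
    obtain ⟨q, rfl⟩ := isOpenQuotientMap_covering.surjective p
    rw [hχ]
    have h1 : (fun p => φ (covering p)) =ᶠ[𝓝 q] fun _ => 0 :=
      isOpenQuotientMap_covering.continuous.continuousAt.eventually
        (notMem_tsupport_iff_eventuallyEq.1 hcon)
    rw [h1.fderiv_eq]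
    simp
  refine ⟨?_, hφ.hasCompactSupport.of_isClosed_subset (isClosed_tsupport χ) hsupp, hsupp.trans hφ.support_subset⟩
  have h1 : ContDiff ℝ ∞ fun q => fderiv ℝ (fun p => φ (covering p)) q h :=
    (hφ.contDiff_covering.fderiv_right (m := ∞) (by simp)).clm_apply contDiff_const
  have h2 : (fun p : (Fin 2 → ℝ) × ℝ => χ (covering p))
      = fun q => fderiv ℝ (fun p => φ (covering p)) q h := funext hχ
  rw [← h2] at h1
  exact h1

lemma IsTestFunction.dx (hφ : IsTestFunction T φ) (i : Fin 2) : IsTestFunction T (dx i φ) :=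
  hφ.of_deriv _ (hφ.dx_covering i)

lemma IsTestFunction.dt (hφ : IsTestFunction T φ) : IsTestFunction T (dt φ) :=
  hφ.of_deriv _ hφ.dt_covering

lemma IsTestFunction.eq_zero_of_notMem (hφ : IsTestFunction T φ) (x : Torus) {t : ℝ}
    (ht : t ∉ Ioo (-T) T) : φ (x, t) = 0 :=
  image_eq_zero_of_notMem_tsupport fun h => ht (hφ.support_subset h).2

lemma IsTestFunction.continuous_slice (hφ : IsTestFunction T φ) (t : ℝ) :
    Continuous fun x => φ (x, t) := hφ.continuous.comp (by fun_prop)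

lemma IsTestFunction.memLp_slice (hφ : IsTestFunction T φ) (t : ℝ) :
    MemLp (fun x => φ (x, t)) 2 torusMeasure := by
  obtain ⟨C, hC⟩ := hφ.exists_bound
  exact MemLp.of_bound (hφ.continuous_slice t).aestronglyMeasurable C
    (Eventually.of_forall fun x => hC _)

lemma IsTestFunction.norm_fourierC_le (hφ : IsTestFunction T φ) :
    ∃ C, ∀ t k, ‖fourierC (fun x => φ (x, t)) k‖ ≤ C := by
  obtain ⟨C, hC⟩ := hφ.exists_bound
  refine ⟨C, fun t k => (norm_fourierC_le_integral _ k).trans ?_⟩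
  calc ∫ x, ‖φ (x, t)‖ ∂torusMeasure ≤ ∫ _, C ∂torusMeasure :=
        integral_mono (((hφ.memLp_slice t).integrable (by norm_num)).norm) (integrable_const _)
          fun x => hC _
    _ = C := by simp

lemma hasDerivAt_fourierC_of_bound {F F' : ℝ → Torus → ℝ} {C : ℝ} (hF : ∀ s, Continuous (F s))
    (hF' : ∀ s, Continuous (F' s)) (hC : ∀ s x, ‖F' s x‖ ≤ C)
    (hd : ∀ s x, HasDerivAt (fun r => F r x) (F' s x) s) (k : Fin 2 → ℤ) (t : ℝ) :
    HasDerivAt (fun s => fourierC (F s) k) (fourierC (F' t) k) t := by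
  have hm : ∀ {f : Torus → ℝ}, Continuous f → Continuous fun x =>
      mFourier (-k) x * (f x : ℂ) := fun hf =>
    (ContinuousMap.continuous _).mul (Complex.continuous_ofReal.comp hf)
  refine (hasDerivAt_integral_of_dominated_loc_of_deriv_le (μ := torusMeasure) (s := univ)
    (F := fun s x => mFourier (-k) x * (F s x : ℂ))
    (F' := fun s x => mFourier (-k) x * (F' s x : ℂ)) (bound := fun _ => C)
    univ_mem (Eventually.of_forall fun s => (hm (hF s)).aestronglyMeasurable)
    ((hm (hF t)).integrable_of_hasCompactSupport (HasCompactSupport.of_compactSpace _))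
    (hm (hF' t)).aestronglyMeasurable
    (Eventually.of_forall fun x s _ => ?_) (integrable_const _)
    (Eventually.of_forall fun x s _ => ?_)).2
  · rw [norm_mul, norm_mFourier_apply, one_mul, Complex.norm_real]
    exact hC s x
  · exact (hd s x).ofReal_comp.const_mul _

lemma IsTestFunction.hasDerivAt_fourierC (hφ : IsTestFunction T φ) (k : Fin 2 → ℤ) (t : ℝ) :
    HasDerivAt (fun s => fourierC (fun x => φ (x, s)) k)
      (fourierC (fun x => SQG.dt φ (x, t)) k) t := by
  obtain ⟨C, hC⟩ := hφ.dt.exists_bound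
  exact hasDerivAt_fourierC_of_bound (F := fun s x => φ (x, s))
    (F' := fun s x => SQG.dt φ (x, s)) hφ.continuous_slice hφ.dt.continuous_slice
    (fun s x => hC _) (fun s x => hφ.hasDerivAt_dt x s) k t

lemma mFourier_single_coe (k : Fin 2 → ℤ) (i : Fin 2) (s : ℝ) :
    mFourier k (Pi.single i (s : UnitAddCircle) : Torus)
      = Complex.exp (2 * Real.pi * Complex.I * (k i : ℂ) * s) := by
  have h : mFourier k (Pi.single i (s : UnitAddCircle) : Torus)
      = ∏ j, fourier (k j) ((Pi.single i (s : UnitAddCircle) : Torus) j) := rfl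
  rw [h, Finset.prod_eq_single i]
  · rw [Pi.single_eq_same, fourier_coe_apply]
    simp
  · intro j _ hj
    rw [Pi.single_eq_of_ne hj, fourier_eval_zero]
  · simp

lemma mFourier_apply_add (k : Fin 2 → ℤ) (x y : Torus) :
    mFourier k (x + y) = mFourier k x * mFourier k y := by
  have h : ∀ x : Torus, mFourier k x = ∏ j, fourier (k j) (x j) := fun _ => rfl
  rw [h, h, h, ← Finset.prod_mul_distrib]
  refine Finset.prod_congr rfl fun j _ => ?_
  rw [Pi.add_apply, fourier_apply, fourier_apply, fourier_apply, smul_add, AddCircle.toCircle_add,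
    Circle.coe_mul]

lemma fourierC_translate (f : Torus → ℝ) (i : Fin 2) (k : Fin 2 → ℤ) (s : ℝ) :
    fourierC (fun x => f (x + Pi.single i (s : UnitAddCircle))) k
      = Complex.exp (2 * Real.pi * Complex.I * (k i : ℂ) * s) * fourierC f k := by
  rw [← mFourier_single_coe]
  generalize (Pi.single i (s : UnitAddCircle) : Torus) = y
  have h3 := integral_add_right_eq_self (μ := torusMeasure)
    (fun x => mFourier (-k) x * (f x : ℂ)) y
  rw [fourierC_eq, fourierC_eq, ← h3, ← integral_const_mul]
  refine integral_congr_ae (Eventually.of_forall fun x => ?_)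
  simp only
  have h4 : mFourier k y * mFourier (-k) y = 1 := by
    rw [← mFourier_add, add_neg_cancel, mFourier_zero, ContinuousMap.one_apply]
  rw [mFourier_apply_add]
  linear_combination (-(mFourier (-k) x * (f (x + y) : ℂ))) * h4

lemma IsTestFunction.continuous_translate (hφ : IsTestFunction T φ) (y : Torus) (t : ℝ) :
    Continuous fun x => φ (x + y, t) :=
  hφ.continuous.comp ((continuous_add_const y).prodMk continuous_const)

/-- The coefficient of a translate is differentiated in two ways at s = 0: under the integral, and
through the factor exp(2πi kᵢ s) given by invariance of Haar measure. This replaces an integration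
by parts on the torus. -/
lemma IsTestFunction.fourierC_dx (hφ : IsTestFunction T φ) (i : Fin 2) (k : Fin 2 → ℤ) (t : ℝ) :
    fourierC (fun x => SQG.dx i φ (x, t)) k
      = 2 * Real.pi * Complex.I * (k i : ℂ) * fourierC (fun x => φ (x, t)) k := by
  obtain ⟨C, hC⟩ := (hφ.dx i).exists_bound
  have h1 := hasDerivAt_fourierC_of_bound
    (F := fun (s : ℝ) x => φ (x + Pi.single i (s : UnitAddCircle), t))
    (F' := fun (s : ℝ) x => SQG.dx i φ (x + Pi.single i (s : UnitAddCircle), t))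
    (fun s => hφ.continuous_translate _ t) (fun s => (hφ.dx i).continuous_translate _ t)
    (fun s x => hC _) (fun s x => hφ.hasDerivAt_dx i x t s) k 0
  have h2 := fun s => fourierC_translate (fun x => φ (x, t)) i k s
  simp only [h2] at h1
  have h5 : HasDerivAt (fun s : ℝ => Complex.exp (2 * Real.pi * Complex.I * (k i : ℂ) * s)
      * fourierC (fun x => φ (x, t)) k)
      (2 * Real.pi * Complex.I * (k i : ℂ) * fourierC (fun x => φ (x, t)) k) 0 := by
    have h6 : HasDerivAt (fun s : ℝ => 2 * Real.pi * Complex.I * (k i : ℂ) * (s : ℂ))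
        (2 * Real.pi * Complex.I * (k i : ℂ)) 0 := by
      simpa using (Complex.ofRealCLM.hasDerivAt (x := (0 : ℝ))).const_mul
        (2 * Real.pi * Complex.I * (k i : ℂ))
    have h7 := (h6.cexp).mul_const (fourierC (fun x => φ (x, t)) k)
    simpa using h7
  rw [← h1.unique h5]
  simp

/-- Four derivatives in each direction give the decay |k|⁻⁴. The nonlinearity costs one factor |k|,
and the remaining |k|⁻³ is summable on a lattice of rank two. -/
lemma IsTestFunction.exists_decay (hφ : IsTestFunction T φ) :
    ∃ C, ∀ t k, ‖fourierC (fun x => φ (x, t)) k‖ ≤ C * (1 + ‖k‖ ^ 4)⁻¹ := by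
  obtain ⟨C, hC⟩ := hφ.norm_fourierC_le
  have h4 : ∀ i, ∃ C, ∀ t (k : Fin 2 → ℤ), |(k i : ℝ)| ^ 4 * ‖fourierC (fun x => φ (x, t)) k‖ ≤ C := by
    intro i
    obtain ⟨C', hC'⟩ := ((((hφ.dx i).dx i).dx i).dx i).norm_fourierC_le
    refine ⟨C', fun t k => le_trans ?_ (hC' t k)⟩
    rw [(((hφ.dx i).dx i).dx i).fourierC_dx, ((hφ.dx i).dx i).fourierC_dx, (hφ.dx i).fourierC_dx,
      hφ.fourierC_dx]
    simp only [norm_mul, Complex.norm_real, Complex.norm_I, Complex.norm_intCast,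
        Complex.norm_ofNat, Real.norm_of_nonneg Real.pi_pos.le, mul_one]
    have hpi : (1 : ℝ) ≤ 2 * Real.pi := by linarith [Real.pi_gt_three]
    have e : ∀ p x y : ℝ, p * x * (p * x * (p * x * (p * x * y))) = p ^ 4 * (x ^ 4 * y) := by
      intros; ring
    rw [e]
    exact le_mul_of_one_le_left (by positivity) (one_le_pow₀ hpi)
  obtain ⟨C0, h0⟩ := h4 0
  obtain ⟨C1, h1⟩ := h4 1
  refine ⟨C + (C0 + C1), fun t k => ?_⟩
  rw [← div_eq_mul_inv, le_div_iff₀ (by positivity), mul_add, mul_one]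
  refine add_le_add (hC t k) ?_
  have hk : ‖k‖ ^ 4 ≤ |(k 0 : ℝ)| ^ 4 + |(k 1 : ℝ)| ^ 4 := by
    have hk' : ‖k‖ ≤ max |(k 0 : ℝ)| |(k 1 : ℝ)| :=
      (pi_norm_le_iff_of_nonneg (le_max_of_le_left (abs_nonneg _))).2 fun i => by
        rw [Int.norm_eq_abs]
        fin_cases i
        · exact le_max_left _ _
        · exact le_max_right _ _
    rcases le_total |(k 0 : ℝ)| |(k 1 : ℝ)| with h | h
    · rw [max_eq_right h] at hk'
      exact (pow_le_pow_left₀ (norm_nonneg _) hk' 4).trans (le_add_of_nonneg_left (by positivity))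
    · rw [max_eq_left h] at hk'
      exact (pow_le_pow_left₀ (norm_nonneg _) hk' 4).trans (le_add_of_nonneg_right (by positivity))
  calc ‖fourierC (fun x => φ (x, t)) k‖ * ‖k‖ ^ 4
      ≤ ‖fourierC (fun x => φ (x, t)) k‖ * (|(k 0 : ℝ)| ^ 4 + |(k 1 : ℝ)| ^ 4) :=
        mul_le_mul_of_nonneg_left hk (norm_nonneg _)
    _ = |(k 0 : ℝ)| ^ 4 * ‖fourierC (fun x => φ (x, t)) k‖
        + |(k 1 : ℝ)| ^ 4 * ‖fourierC (fun x => φ (x, t)) k‖ := by ring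
    _ ≤ _ := add_le_add (h0 t k) (h1 t k)

lemma summable_decay_weight :
    Summable fun k : Fin 2 → ℤ => (1 + freqNorm k) * (1 + ‖k‖ ^ 4)⁻¹ := by
  have h1 := (summable_norm_inv_pow (le_refl 3)).mul_left 3
  have h2 : Summable fun k : Fin 2 → ℤ => if k = 0 then (1 : ℝ) else 0 :=
    (hasSum_ite_eq 0 1).summable
  refine (h1.add h2).of_nonneg_of_le (fun k => ?_) fun k => ?_
  · have := freqNorm_nonneg k
    positivity
  rcases eq_or_ne k 0 with rfl | hk
  · simp [freqNorm_zero]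
  · have hk1 := one_le_norm hk
    have hk2 := freqNorm_le_two_mul_norm k
    rw [if_neg hk, add_zero, ← div_eq_mul_inv, ← div_eq_mul_inv,
      div_le_div_iff₀ (by positivity) (by positivity)]
    have h3 : 1 + freqNorm k ≤ 3 * ‖k‖ := by linarith
    calc (1 + freqNorm k) * ‖k‖ ^ 3 ≤ 3 * ‖k‖ * ‖k‖ ^ 3 :=
          mul_le_mul_of_nonneg_right h3 (by positivity)
      _ ≤ 3 * (1 + ‖k‖ ^ 4) := by nlinarith

lemma IsTestFunction.summable_fourierC (hφ : IsTestFunction T φ) (t : ℝ) :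
    Summable fun k => ‖fourierC (fun x => φ (x, t)) k‖ := by
  obtain ⟨C, hC⟩ := hφ.exists_decay
  have h : Summable fun k : Fin 2 → ℤ => (1 + ‖k‖ ^ 4)⁻¹ :=
    summable_decay_weight.of_nonneg_of_le (fun k => by positivity) fun k =>
      le_mul_of_one_le_left (by positivity) (le_add_of_nonneg_right (freqNorm_nonneg k))
  exact (h.mul_left C).of_nonneg_of_le (fun _ => norm_nonneg _) (hC t)

/-- Parseval's identity for an integrable function and a function with absolutely convergent
Fourier series. -/
lemma hasSum_fourierC_mul_of_summable {f g : Torus → ℝ} (hf : Continuous f)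
    (hfs : Summable fun k => ‖fourierC f k‖) (hg : Integrable g torusMeasure) :
    HasSum (fun k => conj (fourierC f k) * fourierC g k)
      ((∫ x, f x * g x ∂torusMeasure : ℝ) : ℂ) := by
  let F : C(Torus, ℂ) := ⟨fun x => (f x : ℂ), Complex.continuous_ofReal.comp hf⟩
  have hF : Summable (mFourierCoeff F) := hfs.of_norm
  -- The absolutely convergent Fourier series of `f` is expanded pointwise and integrated term by
  -- term against `g`.
  have hpt : ∀ x, HasSum (fun k => conj (fourierC f k) * (mFourier (-k) x * (g x : ℂ)))
      ((f x * g x : ℝ) : ℂ) := fun x => by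
    have h1 := hasSum_mFourier_series_apply_of_summable hF x
    have h2 := (Complex.hasSum_conj'.2 h1).mul_right (g x : ℂ)
    have h3 : ∀ k, conj (mFourierCoeff F k • mFourier k x) * (g x : ℂ)
        = conj (fourierC f k) * (mFourier (-k) x * (g x : ℂ)) := fun k => by
      rw [smul_eq_mul, map_mul, ← mFourier_neg, mul_assoc]
      rfl
    simp only [h3] at h2
    have h4 : ((f x * g x : ℝ) : ℂ) = conj (F x) * (g x : ℂ) := by
      rw [Complex.ofReal_mul]
      exact congrArg (· * (g x : ℂ)) (Complex.conj_ofReal _).symm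
    rw [h4]
    exact h2
  have hi : ∀ k, Integrable (fun x => conj (fourierC f k) * (mFourier (-k) x * (g x : ℂ)))
      torusMeasure := fun k => (integrable_mFourier_mul hg _).const_mul _
  have h := hasSum_integral_of_summable_integral_norm hi (by
    simp only [norm_mul, RCLike.norm_conj, norm_mFourier_apply, one_mul, Complex.norm_real]
    simp only [integral_const_mul]
    exact hfs.mul_right _)
  simp only [integral_const_mul] at h
  have he : ((∫ x, f x * g x ∂torusMeasure : ℝ) : ℂ)
      = ∫ x, ∑' k, conj (fourierC f k) * (mFourier (-k) x * (g x : ℂ)) ∂torusMeasure := by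
    rw [← integral_complex_ofReal]
    exact integral_congr_ae (Eventually.of_forall fun x => (hpt x).tsum_eq.symm)
  rw [he]
  exact h

end TestFunctions

/-! ### Summation over modes and the weak formulation of the limit. -/

section WeakSolution

variable {T : ℝ} {φ : Torus × ℝ → ℝ}

lemma IsTestFunction.aestronglyMeasurable (hφ : IsTestFunction T φ) :
    AEStronglyMeasurable φ (spaceTimeMeasure T) :=
  hφ.continuous.aestronglyMeasurable

lemma integrable_mul_test {f : Torus × ℝ → ℝ} (hf : Integrable f (spaceTimeMeasure T))
    (hφ : IsTestFunction T φ) : Integrable (fun p => f p * φ p) (spaceTimeMeasure T) := by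
  obtain ⟨C, hC⟩ := hφ.exists_bound
  exact hf.mul_bdd (c := C) hφ.aestronglyMeasurable (Eventually.of_forall hC)

lemma integrable_weak_integrand (w : L2ST T) (v : Fin 2 → L2ST T) (hφ : IsTestFunction T φ) :
    Integrable (fun p => w p * (dt φ p + ∑ i, v i p * dx i φ p)) (spaceTimeMeasure T) := by
  have h0 := integrable_mul_test (integrable_of_memLp_two (Lp.memLp w)) hφ.dt
  have h1 : ∀ i, Integrable (fun p => w p * v i p * dx i φ p) (spaceTimeMeasure T) := fun i =>
    integrable_mul_test ((Lp.memLp w).integrable_mul (Lp.memLp (v i))) (hφ.dx i)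
  refine (h0.add ((h1 0).add (h1 1))).congr (Eventually.of_forall fun p => ?_)
  simp only [Pi.add_apply, Fin.sum_univ_two]
  ring

lemma integral_slab_eq {f : Torus × ℝ → ℝ} (hf : Integrable f (spaceTimeMeasure T)) {s : ℝ}
    (hs : s ∈ Ico (-T) T) :
    ∫ p in univ ×ˢ Ioo s T, f p ∂(torusMeasure.prod volume)
      = ∫ t in Ioo s T, ∫ x, f (x, t) ∂torusMeasure := by
  have h1 : ∀ S : Set ℝ, (torusMeasure.prod volume).restrict (univ ×ˢ S)
      = torusMeasure.prod ((volume : Measure ℝ).restrict S) := fun S => by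
    rw [← Measure.prod_restrict, Measure.restrict_univ]
  have h2 : Integrable f (torusMeasure.prod ((volume : Measure ℝ).restrict (Ioo s T))) := by
    rw [← h1]
    have h3 : IntegrableOn f (univ ×ˢ Ioo (-T) T) (torusMeasure.prod volume) := by
      rw [IntegrableOn, h1]
      exact hf
    exact h3.mono_set (prod_mono_right (Ioo_subset_Ioo_left hs.1))
  rw [h1, integral_prod_symm _ h2]

/-- The weak formulation on a time slice in terms of Fourier coefficients. -/
lemma hasSum_slice {f ψ : Torus → ℝ} {v : Fin 2 → Torus → ℝ} (hφ : IsTestFunction T φ) {t : ℝ}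
    (hf : MemLp f 2 torusMeasure) (hv : ∀ i, MemLp (v i) 2 torusMeasure)
    (hψ : IsStreamFunction f ψ) (hvψ : IsPerpGrad ψ v) :
    HasSum (fun k => fourierC f k * conj (fourierC (fun x => dt φ (x, t)) k)
        + nonlin (fourierC f) k * conj (fourierC (fun x => φ (x, t)) k))
      ((∫ x, f x * (dt φ (x, t) + ∑ i, v i x * dx i φ (x, t)) ∂torusMeasure : ℝ) : ℂ) := by
  have hfv : ∀ i, Integrable (fun x => f x * v i x) torusMeasure := fun i =>
    hf.integrable_mul (hv i)
  have h0 := hasSum_fourierC_mul (hφ.dt.memLp_slice t) hf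
  -- The product of `f` and `v i` is only integrable, so the L² Parseval identity does not apply;
  -- the absolutely convergent series of the test function takes its place.
  have h1 : ∀ i, HasSum (fun k => conj (fourierC (fun x => dx i φ (x, t)) k)
      * fourierC (fun x => f x * v i x) k)
      ((∫ x, dx i φ (x, t) * (f x * v i x) ∂torusMeasure : ℝ) : ℂ) := fun i =>
    hasSum_fourierC_mul_of_summable ((hφ.dx i).continuous_slice t) ((hφ.dx i).summable_fourierC t)
      (hfv i)
  have hs := h0.add (hasSum_sum fun i (_ : i ∈ Finset.univ) => h1 i)
  have hterm : ∀ k, fourierC f k * conj (fourierC (fun x => dt φ (x, t)) k)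
        + nonlin (fourierC f) k * conj (fourierC (fun x => φ (x, t)) k)
      = conj (fourierC (fun x => dt φ (x, t)) k) * fourierC f k
        + ∑ i, conj (fourierC (fun x => dx i φ (x, t)) k) * fourierC (fun x => f x * v i x) k := by
    intro k
    rw [← sum_fourierC_mul_eq_nonlin hf hv hψ hvψ k, Finset.sum_mul]
    congr 1
    · ring
    · refine Finset.sum_congr rfl fun i _ => ?_
      rw [hφ.fourierC_dx]
      simp only [map_mul, Complex.conj_I, Complex.conj_ofReal, map_ofNat, map_intCast]
      ring
  have hi0 : Integrable (fun x => dt φ (x, t) * f x) torusMeasure :=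
    (hφ.dt.memLp_slice t).integrable_mul hf
  have hi1 : ∀ i, Integrable (fun x => dx i φ (x, t) * (f x * v i x)) torusMeasure := fun i => by
    obtain ⟨C, hC⟩ := (hφ.dx i).exists_bound
    exact (hfv i).bdd_mul (c := C) ((hφ.dx i).continuous_slice t).aestronglyMeasurable
      (Eventually.of_forall fun x => hC _)
  have hint : ∫ x, f x * (dt φ (x, t) + ∑ i, v i x * dx i φ (x, t)) ∂torusMeasure
      = ∫ x, dt φ (x, t) * f x ∂torusMeasure
        + ∑ i, ∫ x, dx i φ (x, t) * (f x * v i x) ∂torusMeasure := by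
    rw [← integral_finsetSum _ fun i _ => hi1 i,
      ← integral_add hi0 (integrable_finsetSum _ fun i _ => hi1 i)]
    refine integral_congr_ae (Eventually.of_forall fun x => ?_)
    simp only [Fin.sum_univ_two]
    ring
  rw [hint]
  push_cast
  simp only [hterm]
  exact hs

variable {α : ℕ → ℝ} {θ₀ : H1dot} {θ : ℕ → ℝ → H1dot} {w : L2ST T}

/-- One statement for both clauses of the weak formulation, which correspond to s = −T and s = 0.
The family `L` is the boundary term at time s, mode by mode, and must not depend on n. -/
lemma weak_form_limit (hα : Tendsto α atTop (𝓝 0)) {M : ℝ} (hM : ∀ n, energy (α n) θ₀ ≤ M)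
    (hθ : ∀ n, IsRegularizedSolution (α n) θ₀ (θ n))
    (haw : ∀ᵐ t ∂(timeMeasure T), ∀ k, Tendsto (fun n => fourierC (h1Val (θ n t)) k) atTop
      (𝓝 (fourierC (fun x => w (x, t)) k)))
    {ψ : L2ST T} {v : Fin 2 → L2ST T}
    (hψv : ∀ᵐ t ∂(timeMeasure T),
      IsStreamFunction (fun x => w (x, t)) (fun x => ψ (x, t)) ∧
      IsPerpGrad (fun x => ψ (x, t)) (fun i x => v i (x, t)))
    (hφ : IsTestFunction T φ) {s : ℝ} (hs : s ∈ Ico (-T) T) {L : (Fin 2 → ℤ) → ℂ} {R : ℝ}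
    (hL : ∀ n k, fourierC (h1Val (θ n s)) k * conj (fourierC (fun x => φ (x, s)) k) = L k)
    (hR : HasSum L (R : ℂ)) :
    ∫ p in univ ×ˢ Ioo s T, w p * (dt φ p + ∑ i, v i p * dx i φ p)
      ∂(torusMeasure.prod volume) = - R := by
  have hsub : Ioo s T ⊆ Ioo (-T) T := Ioo_subset_Ioo_left hs.1
  have hae : ∀ {p : ℝ → Prop}, (∀ᵐ t ∂(timeMeasure T), p t) →
      ∀ᵐ t ∂((volume : Measure ℝ).restrict (Ioo s T)), p t := fun h =>
    ae_restrict_of_ae_restrict_of_subset hsub h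
  have hM0 : 0 ≤ M := (by unfold energy; positivity : 0 ≤ energy (α 0) θ₀).trans (hM 0)
  obtain ⟨C, hC⟩ := hφ.exists_decay
  obtain ⟨C', hC'⟩ := hφ.dt.exists_decay
  set η : (Fin 2 → ℤ) → ℝ → ℂ := fun k t => conj (fourierC (fun x => φ (x, t)) k) with hη
  set η' : (Fin 2 → ℤ) → ℝ → ℂ := fun k t => conj (fourierC (fun x => dt φ (x, t)) k) with hη'
  set F : (Fin 2 → ℤ) → ℝ → ℂ := fun k t => fourierC (fun x => w (x, t)) k * η' k t
    + nonlin (fourierC (fun x => w (x, t))) k * η k t with hF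
  have hdη : ∀ k t, HasDerivAt (η k) (η' k t) t := fun k t =>
    (hφ.hasDerivAt_fourierC k t).star
  have hcη' : ∀ k, Continuous (η' k) := fun k => continuous_iff_continuousAt.2 fun t =>
    ((hφ.dt.hasDerivAt_fourierC k t).star).continuousAt
  have hηn : ∀ k t, ‖η k t‖ ≤ C * (1 + ‖k‖ ^ 4)⁻¹ := fun k t => by
    rw [hη, RCLike.norm_conj]
    exact hC t k
  have hηn' : ∀ k t, ‖η' k t‖ ≤ C' * (1 + ‖k‖ ^ 4)⁻¹ := fun k t => by
    rw [hη', RCLike.norm_conj]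
    exact hC' t k
  have hηT : ∀ k, η k T = 0 := fun k => by
    have h : ∀ x, φ (x, T) = 0 := fun x => hφ.eq_zero_of_notMem x fun h => lt_irrefl _ h.2
    simp [hη, h, fourierC_eq]
  have hmode : ∀ k, ∫ t in Ioo s T, F k t = - L k := fun k =>
    weak_form_mode hα hM hθ haw (η := η k) (η' := η' k)
      (D := max (C * (1 + ‖k‖ ^ 4)⁻¹) (C' * (1 + ‖k‖ ^ 4)⁻¹)) (hdη k) (hcη' k)
      (fun t => (hηn k t).trans (le_max_left _ _)) (fun t => (hηn' k t).trans (le_max_right _ _))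
      (hηT k) k hs fun n => hL n k
  have hFm : ∀ k, AEStronglyMeasurable (F k) ((volume : Measure ℝ).restrict (Ioo s T)) := fun k => by
    have hm : AEStronglyMeasurable (F k) (timeMeasure T) :=
      ((integrable_fourierC_slice w k).1.mul (hcη' k).aestronglyMeasurable).add
        ((aestronglyMeasurable_nonlin_limit hθ hM haw k).mul
          (continuous_iff_continuousAt.2 fun t => (hdη k t).continuousAt).aestronglyMeasurable)
    exact hm.mono_measure (Measure.restrict_mono hsub le_rfl)
  set K := Real.sqrt M * |C'| + 2 * Real.pi * M * |C| with hK
  have hK0 : 0 ≤ K := by positivity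
  have hFb : ∀ᵐ t ∂((volume : Measure ℝ).restrict (Ioo s T)), ∀ k,
      ‖F k t‖ ≤ K * ((1 + freqNorm k) * (1 + ‖k‖ ^ 4)⁻¹) := by
    filter_upwards [hae (ae_bounds_limit hM hθ haw)] with t ht k
    have hk := freqNorm_nonneg k
    have hi : 0 ≤ (1 + ‖k‖ ^ 4)⁻¹ := by positivity
    have b1 : ‖η k t‖ ≤ |C| * (1 + ‖k‖ ^ 4)⁻¹ :=
      (hηn k t).trans (mul_le_mul_of_nonneg_right (le_abs_self _) hi)
    have b2 : ‖η' k t‖ ≤ |C'| * (1 + ‖k‖ ^ 4)⁻¹ :=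
      (hηn' k t).trans (mul_le_mul_of_nonneg_right (le_abs_self _) hi)
    calc ‖F k t‖ ≤ Real.sqrt M * (|C'| * (1 + ‖k‖ ^ 4)⁻¹)
          + (2 * Real.pi * freqNorm k * M) * (|C| * (1 + ‖k‖ ^ 4)⁻¹) := by
          refine (norm_add_le _ _).trans (add_le_add ?_ ?_)
          · rw [norm_mul]
            exact mul_le_mul (ht k).1 b2 (norm_nonneg _) (Real.sqrt_nonneg _)
          · rw [norm_mul]
            exact mul_le_mul (ht k).2 b1 (norm_nonneg _) (by positivity)
      _ = (Real.sqrt M * |C'| + 2 * Real.pi * M * |C| * freqNorm k) * (1 + ‖k‖ ^ 4)⁻¹ := by ring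
      _ ≤ (K * (1 + freqNorm k)) * (1 + ‖k‖ ^ 4)⁻¹ := by
          refine mul_le_mul_of_nonneg_right ?_ hi
          rw [hK]
          have e1 : 0 ≤ Real.sqrt M * |C'| * freqNorm k := by positivity
          have e2 : 0 ≤ 2 * Real.pi * M * |C| := by positivity
          linarith
      _ = _ := by ring
  have hFi : ∀ k, Integrable (F k) ((volume : Measure ℝ).restrict (Ioo s T)) := fun k =>
    Integrable.of_bound (hFm k) _ (hFb.mono fun t ht => ht k)
  -- This justifies exchanging the sum over modes with the time integral.
  have hsummable : Summable fun k => ∫ t in Ioo s T, ‖F k t‖ := by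
    refine ((summable_decay_weight.mul_left K).mul_left (T - s)).of_nonneg_of_le
      (fun k => integral_nonneg fun _ => norm_nonneg _) fun k => ?_
    refine (integral_mono_ae (hFi k).norm (integrable_const _)
      (hFb.mono fun t ht => ht k)).trans (le_of_eq ?_)
    rw [setIntegral_const, smul_eq_mul, measureReal_def, Real.volume_Ioo,
      ENNReal.toReal_ofReal (sub_nonneg.2 hs.2.le)]
  have htot := hasSum_integral_of_summable_integral_norm hFi hsummable
  simp only [hmode] at htot
  -- Parseval on almost every slice returns from the modes to the integrand in physical space.
  have hslice : ∀ᵐ t ∂((volume : Measure ℝ).restrict (Ioo s T)), ∑' k, F k t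
      = ((∫ x, w (x, t) * (dt φ (x, t) + ∑ i, v i (x, t) * dx i φ (x, t)) ∂torusMeasure : ℝ)
        : ℂ) := by
    filter_upwards [hae hψv, hae (memLp_L2ST_slice w), hae (memLp_L2ST_slice (v 0)),
      hae (memLp_L2ST_slice (v 1))] with t h1 h2 h3 h4
    refine (hasSum_slice hφ h2 (fun i => ?_) h1.1 h1.2).tsum_eq
    fin_cases i
    · exact h3
    · exact h4
  rw [integral_congr_ae hslice, integral_complex_ofReal] at htot
  have hfin := htot.unique hR.neg
  rw [integral_slab_eq (integrable_weak_integrand w v hφ) hs]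
  exact_mod_cast hfin

theorem isWeakSolution_of_tendsto (hT : 0 < T) {u : ℕ → L2ST T} (hα : ∀ n, 0 < α n)
    (hα0 : Tendsto α atTop (𝓝 0)) (hθ : ∀ n, IsRegularizedSolution (α n) θ₀ (θ n))
    (hu : ∀ n, Represents (u n) (θ n))
    (huw : Tendsto (fun n => toWeakSpace ℝ (L2ST T) (u n)) atTop (𝓝 (toWeakSpace ℝ (L2ST T) w))) :
    IsWeakSolution T (h1Val θ₀) w := by
  obtain ⟨M, hM⟩ := exists_energy_le hα hα0 θ₀
  have haw := ae_tendsto_fourierC hM hθ hu huw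
  obtain ⟨ψ, v, hψv⟩ := exists_stream_velocity (ae_mean_zero_limit haw)
  have hψv' := hψv.mono fun t ht => And.intro ht.1 ht.2.1
  refine ⟨ψ, v, hψv, fun φ hφ => ?_, fun φ hφ => ?_⟩
  -- At s = −T the test function vanishes, so there is no boundary term.
  · have hz : (fun x => φ (x, -T)) = fun _ => 0 := funext fun x =>
      hφ.eq_zero_of_notMem x fun h => lt_irrefl _ h.1
    have h := weak_form_limit hα0 hM hθ haw hψv' hφ (s := -T) ⟨le_rfl, by linarith⟩
      (L := fun _ => 0) (R := 0) (fun n k => by simp [hz, fourierC_eq])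
      (by rw [Complex.ofReal_zero]; exact hasSum_zero)
    rw [h, neg_zero]
  -- At s = 0 every approximation equals θ₀, and Parseval sums the boundary terms to ∫ φ(·,0) θ₀.
  · have hR := hasSum_fourierC_mul (hφ.memLp_slice 0) (Lp.memLp (h1Val θ₀))
    have h := weak_form_limit hα0 hM hθ haw hψv' hφ (s := 0) ⟨by linarith, hT⟩
      (fun n k => by rw [(hθ n).initial, mul_comm]) hR
    rw [h]
    simp only [mul_comm]

end WeakSolution

end SQG

end

theorem theorem4 (T : ℝ) (hT : 0 < T) (θ₀ : SQG.H1dot) :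
    -- every regularized solution defines an element of `L²(Ω × (-T, T))`
    (∀ α ∈ Ioc (0 : ℝ) 1, ∀ θ : ℝ → SQG.H1dot, SQG.IsRegularizedSolution α θ₀ θ →
      ∃ u : SQG.L2ST T, SQG.Represents u θ) ∧
    -- the set of the `θ^α`, `0 < α ≤ 1`, is (relatively) weakly compact
    IsCompact (closure (toWeakSpace ℝ (SQG.L2ST T) '' SQG.regularizedSet T θ₀)) ∧
    -- and (relatively) weakly sequentially compact
    (∀ u : ℕ → SQG.L2ST T, (∀ n, u n ∈ SQG.regularizedSet T θ₀) →
      ∃ (w : SQG.L2ST T) (σ : ℕ → ℕ), StrictMono σ ∧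
        Tendsto (fun n => toWeakSpace ℝ (SQG.L2ST T) (u (σ n))) atTop
          (𝓝 (toWeakSpace ℝ (SQG.L2ST T) w))) ∧
    -- every weak limit as `α → 0` is a weak solution of the SQG equations
    (∀ (α : ℕ → ℝ) (θ : ℕ → ℝ → SQG.H1dot) (u : ℕ → SQG.L2ST T) (w : SQG.L2ST T),
      (∀ n, 0 < α n) → Tendsto α atTop (𝓝 0) →
      (∀ n, SQG.IsRegularizedSolution (α n) θ₀ (θ n)) →
      (∀ n, SQG.Represents (u n) (θ n)) →
      Tendsto (fun n => toWeakSpace ℝ (SQG.L2ST T) (u n)) atTop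
        (𝓝 (toWeakSpace ℝ (SQG.L2ST T) w)) →
      SQG.IsWeakSolution T (SQG.h1Val θ₀) w) := by
  refine ⟨fun α _ θ hθ => hθ.exists_represents, SQG.isCompact_closure_regularizedSet T θ₀,
    fun u hu => SQG.exists_subseq_tendsto_regularizedSet hu,
    fun α θ u w hα hα0 hθ hu huw => SQG.isWeakSolution_of_tendsto hT hα hα0 hθ hu huw⟩
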